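/- Let $n\ge 0$ and let $(X,\mu)$ be a Lebesgue space (standard Borel space, everything mod $0$) with a continuous (atomless) probability measure. Let $\tau=\{\xi_0\succ\xi_1\succ\dots\succ\xi_n\}$ be a finite decreasing sequence (filtration) of measurable partitions of $X$, where $\xi_0$ is the partition into singletons mod $0$ and where, for every $k$, almost every conditional measure $\mu^C$, $C\in\xi_k$, is atomic with finitely many atoms. Let $\operatorname{Tree}_{n+1}$ be the space of isomorphism classes of finite rooted trees with levels $0,1,\dots,n$ (leaves on level $0$, the root alone on level $n$) endowed with a strictly positive probability measure on the leaves, with its natural Borel structure. Almost every $C\in\xi_n$, with the measure $\mu^C$ and the partitions induced on its atoms by $\xi_0,\dots,\xi_n$, is such a tree, and this defines a measurable map (mod $0$) $t_n\colon (X/\xi_n,\mu_{\xi_n})\to\operatorname{Tree}_{n+1}$. Put $\omega_\tau=(t_n)_*\mu_{\xi_n}$, and let the multiplicity function $m_\tau$ send $T\in \operatorname{Tree}_{n+1}$ to the nonincreasing sequence (continued by zeros) of the masses of the atoms of the conditional measure of $\mu_{\xi_n}$ on the fibre $t_n^{-1}(T)$; it is defined $\omega_\tau$-almost everywhere, and $m_\tau(T)=0$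 means that the multiplicity of $T$ is continual. Two filtrations, on $(X,\mu)$ and on $(X',\mu')$, are isomorphic if some isomorphism mod $0$ of the measure spaces takes the $k$th partition of the first to the $k$th partition of the second for all $k=0,\dots,n$. (1) Two such filtrations $\tau,\tau'$ of length $n$ are isomorphic if and only if $\omega_\tau=\omega_{\tau'}$ and $m_\tau=m_{\tau'}$ $\omega_\tau$-almost everywhere. (2) If moreover the conditional measures of every partition $\xi_k$ of $\tau$ are of finitely many metric types (up to null sets), then $\omega_\tau$ is an atomic measure with finitely many atoms, all multiplicities are continual ($m_\tau=0$ $\omega_\tau$-almost everywhere), and a filtration $\tau'$ as above is isomorphic to $\tau$ if and only if $\omega_\tau=\omega_{\tau'}$. (3) For $n=1$, sending a tree to the nonincreasing vector of the masses of its leaves (continued by zeros) is a Borel isomorphism of $\operatorname{Tree}_2$ onto the set of finitely supported ordered probability vectors, and it takes $\omega_\tau$ to the image of $\mu_{\xi_1}$ under the map $C\mapsto(m_1(C)\ge m_2(C)\ge\cdots)$ sending a block to the ordered sequence of the masses of the atoms of $\mu^C$. -/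

import Mathlib

open MeasureTheory ProbabilityTheory
open scoped ENNReal

noncomputable section

namespace VershikFiltration

/-! ### Ordered sequences of masses -/

/-- The nonincreasing rearrangement of a family of masses: the `i`-th term (counted from `0`) is the
`(i+1)`-st largest value, repeated values being counted as often as they occur; if there are fewer
than `i+1` values, it is `0`. -/
def orderedSeq {ι : Type*} (w : ι → ℝ≥0∞) (i : ℕ) : ℝ≥0∞ :=
  sSup {c : ℝ≥0∞ | (i : ℕ∞) + 1 ≤ {y | c ≤ w y}.encard}

/-- The metric type of a measure: the ordered sequence `m₀ ≥ m₁ ≥ …` of the masses of its atoms. -/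
def atomSeq {Y : Type*} [MeasurableSpace Y] (ν : Measure Y) : ℕ → ℝ≥0∞ :=
  orderedSeq fun y => ν {y}

/-! ### Finite measured trees -/

/-- The combinatorial part of a hierarchy on a finite set of leaves, with levels `0, …, n`: the
vertices of level `k` are the blocks of `part k`; level `0` consists of the leaves, level `n` of the
root alone, and edges are inclusions of blocks of consecutive levels. -/
structure TreeShape (n : ℕ) where
  /-- the number of leaves -/
  card : ℕ
  /-- the partition of the leaves into the vertices of each level -/
  part : Fin (n + 1) → Setoid (Fin card)
  mono : Monotone part
  part_zero : part 0 = ⊥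
  part_last : part (Fin.last n) = ⊤

/-- Strictly positive probability vectors on `k` points. -/
abbrev PosProbVector (k : ℕ) : Type :=
  {w : Fin k → ℝ≥0∞ // (∀ i, 0 < w i) ∧ ∑ i, w i = 1}

/-- Finite measured trees with leaves labelled by an initial segment of `ℕ`. Its σ-algebra is that
of a disjoint union, over the countably many shapes, of sets of probability vectors. -/
abbrev LabelledTree (n : ℕ) : Type :=
  Σ s : TreeShape n, PosProbVector s.card

/-- The mass of a leaf. -/
def LabelledTree.mass {n : ℕ} (M : LabelledTree n) (i : Fin M.1.card) : ℝ≥0∞ := M.2.1 i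

/-- Isomorphism of measured trees: a bijection of the leaves that respects the vertices of every
level and preserves the measure. -/
def LabelledTree.Iso {n : ℕ} (M N : LabelledTree n) : Prop :=
  ∃ e : Fin M.1.card ≃ Fin N.1.card,
    (∀ k i j, M.1.part k i j ↔ N.1.part k (e i) (e j)) ∧ ∀ i, M.mass i = N.mass (e i)

/-- Isomorphism as an equivalence relation. -/
def LabelledTree.isoSetoid (n : ℕ) : Setoid (LabelledTree n) where
  r := LabelledTree.Iso
  iseqv :=
    { refl := fun _ => ⟨Equiv.refl _, fun _ _ _ => Iff.rfl, fun _ => rfl⟩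
      symm := by
        rintro M N ⟨e, h₁, h₂⟩
        exact ⟨e.symm, fun k i j => by simp [h₁], fun i => by simp [h₂]⟩
      trans := by
        rintro M N P ⟨e, h₁, h₂⟩ ⟨f, g₁, g₂⟩
        exact ⟨e.trans f, fun k i j => by simp [h₁, g₁], fun i => by simp [h₂, g₂]⟩ }

/-- The space of finite measured trees with levels `0, …, n` (that is, of rank `n + 1`), up to
isomorphism, with the quotient σ-algebra. -/
abbrev Tree (n : ℕ) : Type := Quotient (LabelledTree.isoSetoid n)

/-- The tree with a single leaf. -/
def LabelledTree.point (n : ℕ) : LabelledTree n :=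
  ⟨{ card := 1
     part := fun _ => ⊤
     mono := fun _ _ _ => le_rfl
     part_zero := by ext i j; simp [Subsingleton.elim i j]
     part_last := rfl }, ⟨fun _ => 1, by simp⟩⟩

instance (n : ℕ) : Nonempty (Tree n) := ⟨Quotient.mk _ (LabelledTree.point n)⟩

/-- The ordered vector of the masses of the leaves of a measured tree (continued by zeros). -/
def leafVector (n : ℕ) : Tree n → ℕ → ℝ≥0∞ :=
  Quotient.lift (fun M => orderedSeq M.mass) (by
    rintro M N ⟨e, -, h⟩
    funext i
    have key : ∀ c : ℝ≥0∞, {y | c ≤ M.mass y}.encard = {y | c ≤ N.mass y}.encard := by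
      intro c
      rw [← e.injective.encard_image]
      congr 1
      ext y
      constructor
      · rintro ⟨x, hx, rfl⟩
        simpa [h x] using hx
      · intro hy
        exact ⟨e.symm y, by simpa [h (e.symm y)] using hy, by simp⟩
    simp only [orderedSeq, key])

/-! ### Measurable partitions and conditional measures -/

/-- A measurable partition: the partition into the preimages of points under a measurable map to a
standard Borel space, without loss of generality the real line. -/
structure MeasurablePartition (X : Type*) [MeasurableSpace X] where
  /-- lying in the same block -/
  rel : Setoid X
  exists_measurable : ∃ f : X → ℝ, Measurable f ∧ ∀ x y, rel x y ↔ f x = f y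

namespace MeasurablePartition

variable {X : Type*} [MeasurableSpace X]

/-- The quotient space `X/ξ`, with the quotient σ-algebra. -/
abbrev Quot (ξ : MeasurablePartition X) : Type _ := Quotient ξ.rel

/-- The projection `X → X/ξ`. -/
def proj (ξ : MeasurablePartition X) (x : X) : ξ.Quot := Quotient.mk ξ.rel x

/-- The quotient measure on `X/ξ`. -/
def quotMeasure (ξ : MeasurablePartition X) (μ : Measure X) : Measure ξ.Quot := μ.map ξ.proj

/-- The σ-algebra of measurable sets composed of blocks of `ξ`. -/
@[reducible]
def sigmaAlgebra (ξ : MeasurablePartition X) : MeasurableSpace X :=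
  MeasurableSpace.comap ξ.proj inferInstance

variable [StandardBorelSpace X]

/-- The canonical system of conditional measures `μ^C`, indexed by the blocks `C` of `ξ`. -/
def condMeasure (ξ : MeasurablePartition X) (μ : Measure X) [IsFiniteMeasure μ] :
    ξ.Quot → Measure X :=
  Quotient.lift (fun x => condExpKernel μ ξ.sigmaAlgebra x) (by
    intro x y hxy
    ext s hs
    have hm : Measurable[ξ.sigmaAlgebra] fun z => condExpKernel μ ξ.sigmaAlgebra z s :=
      measurable_condExpKernel hs
    obtain ⟨B, -, hB⟩ := hm (measurableSet_singleton (condExpKernel μ ξ.sigmaAlgebra x s))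
    have hx : x ∈ ξ.proj ⁻¹' B := by rw [hB]; rfl
    have hp : ξ.proj x = ξ.proj y := Quotient.sound hxy
    have hy : y ∈ ξ.proj ⁻¹' B := by
      rw [Set.mem_preimage, ← hp]; exact hx
    rw [hB] at hy
    exact hy.symm)

/-- Almost every conditional measure is an atomic measure with finitely many atoms. -/
def IsDiscrete (ξ : MeasurablePartition X) (μ : Measure X) [IsFiniteMeasure μ] : Prop :=
  ∀ᵐ C ∂(ξ.quotMeasure μ), ∃ s : Finset X, ξ.condMeasure μ C (↑s)ᶜ = 0

/-- There are only finitely many metric types of conditional measures, up to null sets. -/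
def HasFinitelyManyTypes (ξ : MeasurablePartition X) (μ : Measure X) [IsFiniteMeasure μ] : Prop :=
  ∃ F : Set (ℕ → ℝ≥0∞), F.Finite ∧ ∀ᵐ C ∂(ξ.quotMeasure μ), atomSeq (ξ.condMeasure μ C) ∈ F

end MeasurablePartition

/-! ### Finite filtrations -/

/-- A finite decreasing sequence `ξ₀ ≻ ξ₁ ≻ … ≻ ξₙ` of measurable partitions, where `ξ₀` is the
partition into singletons; both conditions are understood mod `0`. -/
structure FiniteFiltration {X : Type*} [MeasurableSpace X] (μ : Measure X) (n : ℕ) where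
  /-- the partitions -/
  part : Fin (n + 1) → MeasurablePartition X
  singletons : ∃ A ∈ ae μ, ∀ x ∈ A, ∀ y ∈ A, (part 0).rel x y → x = y
  decreasing : ∀ k l, k ≤ l →
    ∃ A ∈ ae μ, ∀ x ∈ A, ∀ y ∈ A, (part k).rel x y → (part l).rel x y

namespace FiniteFiltration

variable {X : Type*} [MeasurableSpace X] {μ : Measure X} {n : ℕ}

/-- Isomorphism mod `0`: a bimeasurable measure-preserving bijection between sets of full measure
that takes the partitions of the first filtration, restricted to the first set, to those of the
second one, restricted to the second set. -/
def Isomorphic {X' : Type*} [MeasurableSpace X'] {μ' : Measure X'}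
    (τ : FiniteFiltration μ n) (τ' : FiniteFiltration μ' n) : Prop :=
  ∃ (A : Set X) (A' : Set X') (e : A ≃ᵐ A'),
    MeasurableSet A ∧ MeasurableSet A' ∧ μ Aᶜ = 0 ∧ μ' A'ᶜ = 0 ∧
    MeasurePreserving e (μ.comap Subtype.val) (μ'.comap Subtype.val) ∧
    ∀ k, ∀ x y : A, (τ.part k).rel x y ↔ (τ'.part k).rel (e x) (e y)

/-- The coarsest partition `ξₙ` of the filtration. -/
abbrev last (τ : FiniteFiltration μ n) : MeasurablePartition X := τ.part (Fin.last n)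

variable [StandardBorelSpace X]

/-- All partitions have almost all conditional measures atomic with finitely many atoms. -/
def IsDiscrete [IsFiniteMeasure μ] (τ : FiniteFiltration μ n) : Prop :=
  ∀ k, (τ.part k).IsDiscrete μ

/-- All partitions have finitely many metric types of conditional measures. -/
def HasFinitelyManyTypes [IsFiniteMeasure μ] (τ : FiniteFiltration μ n) : Prop :=
  ∀ k, (τ.part k).HasFinitelyManyTypes μ

/-- `M` is a labelled form of the hierarchy that the filtration induces on the block `C` of `ξₙ`:
the leaves are the points of positive conditional measure (the others are discarded mod `0`), with
these measures as masses, and the vertices are the traces of the blocks of the partitions. -/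
def Represents [IsFiniteMeasure μ] (τ : FiniteFiltration μ n) (C : τ.last.Quot)
    (M : LabelledTree n) : Prop :=
  ∃ e : Fin M.1.card → X, Function.Injective e ∧
    Set.range e = {y | 0 < τ.last.condMeasure μ C {y}} ∧
    (∀ i, M.mass i = τ.last.condMeasure μ C {e i}) ∧
    ∀ k i j, M.1.part k i j ↔ (τ.part k).rel (e i) (e j)

/-- The map `tₙ` from `X/ξₙ` to measured trees (with an arbitrary value on the null set of blocks
that carry no finite hierarchy). -/
def treeMap [IsFiniteMeasure μ] (τ : FiniteFiltration μ n) (C : τ.last.Quot) : Tree n :=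
  Classical.epsilon fun T : Tree n => ∃ M : LabelledTree n, τ.Represents C M ∧ Quotient.mk _ M = T

/-- The measure `ω_τ` on the space of trees: the `tₙ`-image of the quotient measure on `X/ξₙ`. -/
def treeMeasure [IsFiniteMeasure μ] (τ : FiniteFiltration μ n) : Measure (Tree n) :=
  (τ.last.quotMeasure μ).map τ.treeMap

/-- The conditional measure, given the value `T` of `tₙ`, of the quotient measure on `X/ξₙ`. It is
the projection to `X/ξₙ` of the conditional measure of `μ` itself (disintegration is compatible with
the projection). -/
def fibreMeasure [IsProbabilityMeasure μ] (τ : FiniteFiltration μ n) (T : Tree n) :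
    Measure τ.last.Quot :=
  haveI : Nonempty X := nonempty_of_isProbabilityMeasure μ
  (condDistrib id (fun x => τ.treeMap (τ.last.proj x)) μ T).map τ.last.proj

/-- The multiplicity function of the homomorphism `tₙ`: it sends a tree to the metric type of the
conditional measure on its fibre. The zero sequence means that this measure is continuous, that is,
that the multiplicity is continual. -/
def multiplicity [IsProbabilityMeasure μ] (τ : FiniteFiltration μ n) (T : Tree n) : ℕ → ℝ≥0∞ :=
  atomSeq (τ.fibreMeasure T)

end FiniteFiltration

end VershikFiltration

end

/-! Almost every point `x` is described by three coordinates: the tree `T` of its block `C` of the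
last partition, a position of `C` in the fibre of the tree map over `T`, and the number of the leaf
of `T` at which `x` sits. Off a null set these coordinates are injective and determine the
partitions: two points share a block of level `k` exactly when their first two coordinates agree and
their leaves lie under one vertex of level `k`. The joint law of the coordinates depends only on the
measure on trees and on the multiplicities (`exists_model`). Two standard spaces with almost
injective maps to the same target and equal laws are isomorphic over the target
(`exists_equiv_of_map_eq`), since injective Borel images of Borel sets are Borel. So equal
invariants yield an isomorphism.

The position must be measurable in `T`, with a law fixed by the metric type of the fibre. The
function generating the last partition carries the fibre measure to a measure `η` on the line, and
`massRank` sends `r` to its mass and to the mass of the points of equal mass not exceeding `r`. On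
atoms of mass `c` this is `c` and `c` times a rank; on the rest it is `0` and the distribution
function of the atomless part. It is almost injective (`measure_isFlat`, `eq_of_massRank_eq`), and
its law depends only on the ordered masses of atoms (`map_massRank_eq`). Being explicit, it avoids
choosing an isomorphism separately in every fibre.

For the leaf numbers, an isomorphism class of labelled trees is a finite orbit of leaf permutations,
so maximizing a real code gives a Borel representative (`exists_measurable_treeSection`); the atoms
of the conditional measures are then numbered by the first suitable member of a countable list of
labellings (`exists_measurable_labelling`).

Conversely, an isomorphism transports conditional measures (`condDistrib_map_eq_of_compatible`),
hence the trees of blocks and the fibre measures.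

If the last partition has finitely many metric types, only finitely many trees occur, since finitely
many trees share a vector of leaf masses. Over a tree of positive measure the fibre is atomless,
because single blocks are null. For `n = 1` a tree contains nothing beyond its leaf masses. -/

namespace VershikFiltration

/-! ### Ordered sequences of masses and the counting functions they encode -/

section OrderedSeq

variable {ι ι' : Type*}

theorem orderedSeq_antitone (w : ι → ℝ≥0∞) : Antitone (orderedSeq w) := by
  intro i j hij
  refine sSup_le_sSup fun c hc => le_trans (b := (j : ℕ∞) + 1) ?_ hc
  gcongr

theorem orderedSeq_le_of_encard {w : ι → ℝ≥0∞} {w' : ι' → ℝ≥0∞}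
    (h : ∀ c, 0 < c → {y | c ≤ w y}.encard ≤ {y | c ≤ w' y}.encard) (i : ℕ) :
    orderedSeq w i ≤ orderedSeq w' i := by
  refine sSup_le fun c hc => ?_
  rcases eq_or_ne c 0 with rfl | h0
  · exact zero_le
  · exact le_sSup (le_trans hc (h c (pos_iff_ne_zero.2 h0)))

theorem orderedSeq_eq_of_encard {w : ι → ℝ≥0∞} {w' : ι' → ℝ≥0∞}
    (h : ∀ c, 0 < c → {y | c ≤ w y}.encard = {y | c ≤ w' y}.encard) :
    orderedSeq w = orderedSeq w' :=
  funext fun i => le_antisymm (orderedSeq_le_of_encard (fun c hc => (h c hc).le) i)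
    (orderedSeq_le_of_encard (fun c hc => (h c hc).ge) i)

/-- The ordered sequence only depends on the family of nonzero masses. -/
theorem orderedSeq_eq_of_bijOn {w : ι → ℝ≥0∞} {w' : ι' → ℝ≥0∞} (j : ι → ι')
    (hj : Set.BijOn j {y | 0 < w y} {y | 0 < w' y}) (hw : ∀ y, 0 < w y → w' (j y) = w y) :
    orderedSeq w = orderedSeq w' := by
  refine orderedSeq_eq_of_encard fun c hc => ?_
  have hinj : Set.InjOn j {y | c ≤ w y} := hj.injOn.mono fun y hy => lt_of_lt_of_le hc hy
  rw [← hinj.encard_image]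
  congr 1
  ext z
  constructor
  · rintro ⟨y, hy, rfl⟩
    have : 0 < w y := lt_of_lt_of_le hc hy
    simpa [hw y this] using hy
  · intro hz
    obtain ⟨y, hy, rfl⟩ := hj.surjOn (show 0 < w' z from lt_of_lt_of_le hc hz)
    exact ⟨y, by simpa [hw y hy] using hz, rfl⟩

theorem orderedSeq_eq_zero {w : ι → ℝ≥0∞} (hw : ∀ y, w y = 0) : orderedSeq w = 0 := by
  funext i
  refine le_antisymm (sSup_le fun c hc => ?_) zero_le
  by_contra h
  have : {y | c ≤ w y} = ∅ := by
    ext y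
    simp only [Set.mem_ofPred_eq, hw y, Set.mem_empty_iff_false, iff_false]
    exact h
  simp only [Set.mem_ofPred_eq, this, Set.encard_empty, nonpos_iff_eq_zero] at hc
  simp at hc

/-- Only finitely many indices have value at least `c`, so the values above `c` stay away from `c`.
This recovers strict superlevel sets from the non-strict ones that `orderedSeq` counts. -/
theorem eventually_setOf_le_eq_lt {w : ι → ℝ≥0∞} (hw : ∀ c, 0 < c → {y | c ≤ w y}.Finite)
    {c : ℝ≥0∞} (hc : 0 < c) :
    ∀ᶠ d in nhdsWithin c (Set.Ioi c), {y | d ≤ w y} = {y | c < w y} := by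
  have h1 : ∀ᶠ d in nhdsWithin c (Set.Ioi c), ∀ y ∈ {y | c ≤ w y}, c < w y → d ≤ w y := by
    rw [Filter.eventually_all_finite (hw c hc)]
    intro y _
    by_cases hy : c < w y
    · filter_upwards [Ioc_mem_nhdsGT hy] with d hd _ using hd.2
    · exact Filter.Eventually.of_forall fun d h => absurd h hy
  filter_upwards [h1, self_mem_nhdsWithin] with d hd hcd
  ext y
  exact ⟨fun (h : d ≤ w y) => lt_of_lt_of_le hcd h,
    fun (h : c < w y) => hd y h.le h⟩

/-- The supremum defining `orderedSeq` is attained at positive levels: finiteness above some `d0 <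
c` leaves a gap in the values just below `c`. Hence the sequence determines the counting function,
and conversely. -/
theorem le_orderedSeq_iff {w : ι → ℝ≥0∞} (hw : ∀ c, 0 < c → {y | c ≤ w y}.Finite)
    {c : ℝ≥0∞} (hc : 0 < c) (i : ℕ) :
    c ≤ orderedSeq w i ↔ (i : ℕ∞) + 1 ≤ {y | c ≤ w y}.encard := by
  refine ⟨fun h => ?_, fun h => le_sSup h⟩
  obtain ⟨d0, hd0, hd0c⟩ := exists_between hc
  have hlt : ∀ᶠ d in nhdsWithin c (Set.Iio c), ∀ y ∈ {y | d0 ≤ w y}, d ≤ w y → c ≤ w y := by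
    rw [Filter.eventually_all_finite (hw d0 hd0)]
    intro y _
    by_cases hy : c ≤ w y
    · exact Filter.Eventually.of_forall fun d _ => hy
    · filter_upwards [Ioo_mem_nhdsLT (not_le.1 hy)] with d hd h
      exact absurd h (not_le.2 hd.1)
  have : (nhdsWithin c (Set.Iio c)).NeBot := nhdsLT_neBot_of_exists_lt ⟨0, hc⟩
  obtain ⟨d, hd, hdI⟩ := (hlt.and (Ioo_mem_nhdsLT hd0c)).exists
  obtain ⟨e, he, hde⟩ := exists_lt_of_lt_csSup' (lt_of_lt_of_le hdI.2 h)
  refine le_trans he (Set.encard_le_encard fun y hy => ?_)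
  have hdy : d ≤ w y := hde.le.trans hy
  exact hd y (hdI.1.le.trans hdy) hdy

theorem encard_eq_of_orderedSeq_eq {w : ι → ℝ≥0∞} {w' : ι' → ℝ≥0∞}
    (hw : ∀ c, 0 < c → {y | c ≤ w y}.Finite) (hw' : ∀ c, 0 < c → {y | c ≤ w' y}.Finite)
    (h : orderedSeq w = orderedSeq w') {c : ℝ≥0∞} (hc : 0 < c) :
    {y | c ≤ w y}.encard = {y | c ≤ w' y}.encard := by
  have key : ∀ i : ℕ, (i : ℕ∞) + 1 ≤ {y | c ≤ w y}.encard ↔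
      (i : ℕ∞) + 1 ≤ {y | c ≤ w' y}.encard := fun i => by
    rw [← le_orderedSeq_iff hw hc, ← le_orderedSeq_iff hw' hc, h]
  rw [(hw c hc).encard_eq_coe_toFinset_card, (hw' c hc).encard_eq_coe_toFinset_card] at *
  norm_cast at key ⊢
  have h1 := key ((hw c hc).toFinset.card - 1)
  have h2 := key ((hw' c hc).toFinset.card - 1)
  omega

theorem encard_setOf_le_eq_add (w : ι → ℝ≥0∞) (c : ℝ≥0∞) :
    {y | c ≤ w y}.encard = {y | w y = c}.encard + {y | c < w y}.encard := by
  rw [← Set.encard_union_eq]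
  · congr 1
    ext y
    simp only [Set.mem_ofPred_eq, Set.mem_union, le_iff_lt_or_eq, eq_comm (a := c), or_comm]
  · rw [Set.disjoint_left]
    intro y hy hy'
    simp only [Set.mem_ofPred_eq] at hy hy'
    exact absurd hy hy'.ne'

/-- The number of indices of value exactly `c` is the count at `c` minus the count just above `c`.
Both are read off from the sequence, and the subtraction is legitimate because the counts are
finite. -/
theorem encard_setOf_eq_of_orderedSeq_eq {w : ι → ℝ≥0∞} {w' : ι' → ℝ≥0∞}
    (hw : ∀ c, 0 < c → {y | c ≤ w y}.Finite) (hw' : ∀ c, 0 < c → {y | c ≤ w' y}.Finite)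
    (hfin : ∀ y, w y ≠ ∞) (hfin' : ∀ y, w' y ≠ ∞)
    (h : orderedSeq w = orderedSeq w') {c : ℝ≥0∞} (hc : 0 < c) :
    {y | w y = c}.encard = {y | w' y = c}.encard := by
  rcases eq_or_ne c ∞ with rfl | hc'
  · simp [hfin, hfin']
  have : (nhdsWithin c (Set.Ioi c)).NeBot := nhdsGT_neBot_of_exists_gt ⟨∞, hc'.lt_top⟩
  obtain ⟨d, ⟨hd, hd'⟩, hcd⟩ := (((eventually_setOf_le_eq_lt hw hc).and
    (eventually_setOf_le_eq_lt hw' hc)).and self_mem_nhdsWithin).exists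
  have hcd : c < d := hcd
  have e1 : {y | c < w y}.encard = {y | c < w' y}.encard := by
    rw [← hd, ← hd']
    exact encard_eq_of_orderedSeq_eq hw hw' h (hc.trans hcd)
  have e2 := encard_eq_of_orderedSeq_eq hw hw' h hc
  rw [encard_setOf_le_eq_add, encard_setOf_le_eq_add w', e1] at e2
  have hne : {y | c < w' y}.encard ≠ ⊤ := by
    rw [Set.encard_ne_top_iff]
    exact (hw' c hc).subset fun y (hy : c < w' y) => hy.le
  exact WithTop.add_right_cancel hne e2

theorem orderedSeq_of_antitone {k : ℕ} {w : Fin k → ℝ≥0∞} (hw : Antitone w) (i : ℕ) :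
    orderedSeq w i = if h : i < k then w ⟨i, h⟩ else 0 := by
  split_ifs with h
  · refine le_antisymm (sSup_le fun c hc => ?_) (le_sSup ?_)
    · by_contra hlt
      rw [not_le] at hlt
      have hsub : {y | c ≤ w y} ⊆ Set.Iio ⟨i, h⟩ := by
        intro y hy
        by_contra hy'
        exact absurd (hy.trans (hw (not_lt.1 hy'))) (not_le.2 hlt)
      have := (hc : _ ≤ _).trans (Set.encard_le_encard hsub)
      rw [← Finset.coe_Iio, Set.encard_coe_eq_coe_finsetCard] at this
      simp only [Fin.card_Iio] at this
      norm_cast at this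
      exact absurd this (by simp)
    · have hsub : Set.Iic (⟨i, h⟩ : Fin k) ⊆ {y | w ⟨i, h⟩ ≤ w y} := fun y hy => hw hy
      refine le_trans ?_ (Set.encard_le_encard hsub)
      rw [← Finset.coe_Iic, Set.encard_coe_eq_coe_finsetCard]
      simp
  · refine le_antisymm (sSup_le fun c hc => ?_) zero_le
    exfalso
    have := (hc : _ ≤ _).trans (Set.encard_le_encard (Set.subset_univ _))
    rw [Set.encard_univ] at this
    simp only [ENat.card_eq_coe_fintype_card, Fintype.card_fin] at this
    norm_cast at this

/-- Every finite family of masses can be sorted. -/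
theorem exists_antitone_comp_perm {k : ℕ} (w : Fin k → ℝ≥0∞) :
    ∃ σ : Equiv.Perm (Fin k), Antitone (w ∘ σ) :=
  ⟨Tuple.sort (fun i => OrderDual.toDual (w i)), fun _ _ h =>
    Tuple.monotone_sort (fun i => OrderDual.toDual (w i)) h⟩

end OrderedSeq

/-! ### Transport of conditional measures, factorization, and isomorphism from equality of laws -/

section Disintegration

variable {X X' β β' : Type*} [MeasurableSpace X] [MeasurableSpace X'] [MeasurableSpace β]
  [MeasurableSpace β']

/-- Conditional measures are transported by measure-preserving maps that are compatible with the
conditioning σ-algebras. -/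
theorem condDistrib_map_eq_of_compatible [StandardBorelSpace X] [Nonempty X]
    [StandardBorelSpace X'] [Nonempty X']
    {μ : Measure X} {μ' : Measure X'} [IsProbabilityMeasure μ] [IsProbabilityMeasure μ']
    {p : X → β} {p' : X' → β'} {e : X → X'} {u : β → β'}
    (hp : Measurable p) (hp' : Measurable p') (he : MeasurePreserving e μ μ')
    (hu : Measurable u) (hup : ∀ᵐ x ∂μ, p' (e x) = u (p x))
    (hB : ∀ B, MeasurableSet B → ∃ B', MeasurableSet B' ∧
      ∀ᵐ x ∂μ, (p x ∈ B ↔ p' (e x) ∈ B')) :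
    ∀ᵐ b ∂(μ.map p), (condDistrib id p μ b).map e = condDistrib id p' μ' (u b) := by
  have h1 : condDistrib (e ∘ id) p μ =ᵐ[μ.map p] (condDistrib id p μ).map e :=
    condDistrib_comp p aemeasurable_id he.measurable
  -- Conditional laws are unique almost everywhere, so it suffices that the kernel `b ↦ condDistrib
  -- id p' μ' (u b)` reproduces the joint law of `p` and `e` on rectangles. There `hB` replaces an
  -- event of `p` by an event of `p'`.
  have h2 : condDistrib e p μ =ᵐ[μ.map p] (condDistrib id p' μ').comap u hu := by
    refine condDistrib_ae_eq_of_measure_eq_compProd p he.measurable.aemeasurable ?_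
    have : IsProbabilityMeasure (μ.map p) := Measure.isProbabilityMeasure_map hp.aemeasurable
    refine Measure.ext_prod fun {B E} hBm hE => ?_
    obtain ⟨B', hB', hBB'⟩ := hB B hBm
    rw [Measure.compProd_apply_prod hBm hE, Measure.map_apply (hp.prodMk he.measurable)
      (hBm.prod hE)]
    have hk : Measurable fun x' => condDistrib id p' μ' x' E := Kernel.measurable_coe _ hE
    have e1 : ∫⁻ b in B, (condDistrib id p' μ').comap u hu b E ∂(μ.map p)
        = ∫⁻ x in e ⁻¹' (p' ⁻¹' B'), condDistrib id p' μ' (p' (e x)) E ∂μ := by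
      rw [setLIntegral_map hBm (Kernel.measurable_coe _ hE) hp]
      have hset : p ⁻¹' B =ᵐ[μ] e ⁻¹' (p' ⁻¹' B') := by
        filter_upwards [hBB'] with x hx
        exact propext hx
      rw [setLIntegral_congr hset]
      refine lintegral_congr_ae (ae_restrict_of_ae ?_)
      filter_upwards [hup] with x hx
      rw [Kernel.comap_apply, hx]
    have e2 := setLIntegral_map (μ := μ) (hp' hB') (hk.comp hp') he.measurable
    simp only [Function.comp_apply] at e2
    rw [e1, ← e2, he.map_eq,
      setLIntegral_preimage_condDistrib hp' aemeasurable_id hE hB', Set.preimage_id,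
      ← he.measure_preimage ((hp' hB').inter hE).nullMeasurableSet]
    refine measure_congr ?_
    filter_upwards [hBB'] with x hx
    refine propext (and_congr hx Iff.rfl)
  filter_upwards [h1, h2] with b hb1 hb2
  rw [← Kernel.map_apply _ he.measurable, ← hb1, Function.comp_id, hb2, Kernel.comap_apply]

/-- A measurable function that is constant on the fibres of another measurable function, up to a
measurable set, factors through it. -/
theorem exists_measurable_factor [StandardBorelSpace X] [StandardBorelSpace β'] [Nonempty β']
    {A : Set X} (hA : MeasurableSet A) {f : X → ℝ} {g : X → β'} (hf : Measurable f)
    (hg : Measurable g) (h : ∀ x ∈ A, ∀ y ∈ A, f x = f y → g x = g y) :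
    ∃ u : ℝ → β', Measurable u ∧ ∀ x ∈ A, g x = u (f x) := by
  have := hA.standardBorel
  have hfA : Measurable fun x : A => f x := hf.comp measurable_subtype_coe
  have hgA : Measurable[MeasurableSpace.comap (fun x : A => f x) inferInstance]
      fun x : A => g x := by
    intro S hS
    have hS' : MeasurableSet ((fun x : A => f x) ⁻¹' ((fun x : A => f x) ''
        ((fun x : A => g x) ⁻¹' S))) := by
      have : (fun x : A => f x) ⁻¹' ((fun x : A => f x) '' ((fun x : A => g x) ⁻¹' S))
          = (fun x : A => g x) ⁻¹' S := by
        refine Set.Subset.antisymm ?_ (Set.subset_preimage_image _ _)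
        rintro x ⟨y, hy, hxy⟩
        have := h y y.2 x x.2 hxy
        simp only [Set.mem_preimage] at hy ⊢
        rwa [← this]
      rw [this]
      exact (hg.comp measurable_subtype_coe) hS
    -- Here standardness of `A` enters: a subset of the range whose preimage is Borel is itself
    -- measurable in the range (separation of analytic sets).
    rw [hfA.measurableSet_preimage_iff_preimage_val] at hS'
    obtain ⟨V, hV, hVS⟩ := hS'
    refine ⟨V, hV, ?_⟩
    ext x
    have hx : f x ∈ V ↔ (⟨f x, x, rfl⟩ : Set.range fun x : A => f x) ∈
        Subtype.val ⁻¹' ((fun x : A => f x) '' ((fun x : A => g x) ⁻¹' S)) := by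
      rw [← hVS]
      rfl
    refine hx.trans ⟨?_, fun hx => ⟨x, hx, rfl⟩⟩
    rintro ⟨y, hy, hxy⟩
    have := h y y.2 x x.2 hxy
    simp only [Set.mem_preimage] at hy ⊢
    rwa [← this]
  obtain ⟨u, hu, hgu⟩ := hgA.exists_eq_measurable_comp
  exact ⟨u, hu, fun x hx => congrFun hgu ⟨x, hx⟩⟩

/-- Two standard probability spaces with almost injective maps to the same space that have the same
law are isomorphic over that space. -/
theorem exists_equiv_of_map_eq [StandardBorelSpace X] [StandardBorelSpace X']
    [MeasurableSpace.CountablySeparated β]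
    {μ : Measure X} {μ' : Measure X'} {A : Set X} {A' : Set X'} {f : X → β} {f' : X' → β}
    (hA : MeasurableSet A) (hA' : MeasurableSet A') (hμA : μ Aᶜ = 0) (hμA' : μ' A'ᶜ = 0)
    (hf : Measurable f) (hf' : Measurable f') (hfA : Set.InjOn f A) (hfA' : Set.InjOn f' A')
    (h : μ.map f = μ'.map f') :
    ∃ (B : Set X) (B' : Set X') (e : B ≃ᵐ B'), B ⊆ A ∧ B' ⊆ A' ∧
      MeasurableSet B ∧ MeasurableSet B' ∧ μ Bᶜ = 0 ∧ μ' B'ᶜ = 0 ∧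
      MeasurePreserving e (μ.comap Subtype.val) (μ'.comap Subtype.val) ∧
      ∀ x, f' (e x) = f x := by
  have hI : MeasurableSet (f '' A) := hA.image_of_measurable_injOn hf hfA
  have hI' : MeasurableSet (f' '' A') := hA'.image_of_measurable_injOn hf' hfA'
  -- Each side is cut down to the points whose image is also attained on the other side. Equality of
  -- the laws makes the discarded points null, and the two restricted ranges coincide.
  set B := A ∩ f ⁻¹' (f' '' A') with hBdef
  set B' := A' ∩ f' ⁻¹' (f '' A) with hBdef'
  have hB : MeasurableSet B := hA.inter (hf hI')
  have hB' : MeasurableSet B' := hA'.inter (hf' hI)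
  have hμB : μ Bᶜ = 0 := by
    rw [hBdef, Set.compl_inter]
    refine measure_union_null hμA ?_
    rw [← Set.preimage_compl, ← Measure.map_apply hf hI'.compl, h,
      Measure.map_apply hf' hI'.compl]
    exact measure_mono_null (fun x hx hxA => hx ⟨x, hxA, rfl⟩) hμA'
  have hμB' : μ' B'ᶜ = 0 := by
    rw [hBdef', Set.compl_inter]
    refine measure_union_null hμA' ?_
    rw [← Set.preimage_compl, ← Measure.map_apply hf' hI.compl, ← h,
      Measure.map_apply hf hI.compl]
    exact measure_mono_null (fun x hx hxA => hx ⟨x, hxA, rfl⟩) hμA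
  have hsB := hB.standardBorel
  have hsB' := hB'.standardBorel
  have hi : Set.InjOn f B := hfA.mono Set.inter_subset_left
  have hi' : Set.InjOn f' B' := hfA'.mono Set.inter_subset_left
  have himg : Set.range (fun x : B => f x) = Set.range fun x : B' => f' x := by
    ext z
    constructor
    · rintro ⟨⟨x, hx, y, hy, hyx⟩, rfl⟩
      exact ⟨⟨y, hy, x, hx, hyx.symm⟩, hyx⟩
    · rintro ⟨⟨x, hx, y, hy, hyx⟩, rfl⟩
      exact ⟨⟨y, hy, x, hx, hyx.symm⟩, hyx⟩
  have em : MeasurableEmbedding fun x : B => f x :=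
    (hf.comp measurable_subtype_coe).measurableEmbedding (Set.injOn_iff_injective.1 hi)
  have em' : MeasurableEmbedding fun x : B' => f' x :=
    (hf'.comp measurable_subtype_coe).measurableEmbedding (Set.injOn_iff_injective.1 hi')
  have hr : ∀ x : B, f x ∈ Set.range fun x : B' => f' x := fun x => himg ▸ ⟨x, rfl⟩
  have hr' : ∀ x : B', f' x ∈ Set.range fun x : B => f x := fun x => himg ▸ ⟨x, rfl⟩
  have ee : ∀ x, (em.equivRange x : β) = f x := fun x => by rw [em.equivRange_apply]
  have ee' : ∀ x, (em'.equivRange x : β) = f' x := fun x => by rw [em'.equivRange_apply]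
  have hsymm : ∀ z, f' (em'.equivRange.symm z) = z := fun z =>
    by rw [← ee', em'.equivRange.apply_symm_apply]
  have hsymm' : ∀ z, f (em.equivRange.symm z) = z := fun z =>
    by rw [← ee, em.equivRange.apply_symm_apply]
  let e : B ≃ᵐ B' :=
    { toFun := fun x => em'.equivRange.symm ⟨f x, hr x⟩
      invFun := fun x => em.equivRange.symm ⟨f' x, hr' x⟩
      left_inv := fun x => em.injective (by simp only [hsymm', hsymm])
      right_inv := fun x => em'.injective (by simp only [hsymm', hsymm])
      measurable_toFun := em'.equivRange.symm.measurable.comp (em.measurable.subtype_mk)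
      measurable_invFun := em.equivRange.symm.measurable.comp (em'.measurable.subtype_mk) }
  have he : ∀ x, f' (e x) = f x := fun x => hsymm _
  refine ⟨B, B', e, Set.inter_subset_left, Set.inter_subset_left, hB, hB', hμB, hμB', ?_, he⟩
  refine ⟨e.measurable, ?_⟩
  ext S hS
  rw [e.map_apply, (MeasurableEmbedding.subtype_coe hB).comap_apply,
    (MeasurableEmbedding.subtype_coe hB').comap_apply]
  have hS' : MeasurableSet (f' '' (Subtype.val '' S)) :=
    ((MeasurableEmbedding.subtype_coe hB').measurableSet_image' hS).image_of_measurable_injOn hf'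
      (hi'.mono (Subtype.coe_image_subset _ _))
  have k1 : μ (Subtype.val '' (e ⁻¹' S)) = μ (f ⁻¹' (f' '' (Subtype.val '' S))) := by
    refine measure_congr ?_
    have : ∀ᵐ x ∂μ, x ∈ B := hμB
    filter_upwards [this] with x hx
    refine propext ⟨?_, ?_⟩
    · rintro ⟨y, hy, rfl⟩
      exact ⟨e y, ⟨e y, hy, rfl⟩, he y⟩
    · rintro ⟨_, ⟨y, hy, rfl⟩, hyx⟩
      refine ⟨⟨x, hx⟩, ?_, rfl⟩
      have : e ⟨x, hx⟩ = y := em'.injective (by simp only [he, hyx])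
      rwa [Set.mem_preimage, this]
  have k2 : μ' (Subtype.val '' S) = μ' (f' ⁻¹' (f' '' (Subtype.val '' S))) := by
    refine measure_congr ?_
    have : ∀ᵐ x ∂μ', x ∈ B' := hμB'
    filter_upwards [this] with x hx
    refine propext ⟨fun h => ⟨x, h, rfl⟩, ?_⟩
    rintro ⟨_, ⟨y, hy, rfl⟩, hyx⟩
    rw [← hi' y.2 hx hyx]
    exact ⟨y, hy, rfl⟩
  rw [k1, k2, ← Measure.map_apply hf hS', h, Measure.map_apply hf' hS']

end Disintegration

/-! ### Countable disjoint unions of standard Borel spaces -/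

section Sigma

variable {ι : Type*} {E : ι → Type*} [∀ i, MeasurableSpace (E i)]

theorem measurableSet_sigma_iff {U : Set (Σ i, E i)} :
    MeasurableSet U ↔ ∀ i, MeasurableSet (Sigma.mk i ⁻¹' U) := by
  simp only [MeasurableSpace.measurableSet_iInf]
  rfl

theorem measurable_sigma_iff {γ : Type*} [MeasurableSpace γ] {f : (Σ i, E i) → γ} :
    Measurable f ↔ ∀ i, Measurable fun w => f ⟨i, w⟩ :=
  ⟨fun h i _ hS => measurableSet_sigma_iff.1 (h hS) i,
    fun h _ hS => measurableSet_sigma_iff.2 fun i => h i hS⟩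

theorem measurable_sigma_mk (i : ι) : Measurable (Sigma.mk i : E i → Σ i, E i) :=
  fun _ hU => measurableSet_sigma_iff.1 hU i

theorem standardBorelSpace_of_measurableEmbedding {α β : Type*} [MeasurableSpace α]
    [MeasurableSpace β] [StandardBorelSpace β] {f : α → β} (hf : MeasurableEmbedding f) :
    StandardBorelSpace α := by
  have := hf.measurableSet_range.standardBorel
  obtain ⟨t, h1, h2⟩ := this
  have e := hf.equivRange
  let := t
  let tα : TopologicalSpace α := t.induced e
  refine ⟨tα, ⟨?_⟩, ?_⟩
  · rw [borel_comap, ← h1.measurable_eq]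
    exact e.measurableEmbedding.comap_eq.symm
  · exact (Equiv.polishSpace_induced e.toEquiv :)

instance [Countable ι] [∀ i, StandardBorelSpace (E i)] : StandardBorelSpace (Σ i, E i) := by
  obtain ⟨enc, henc⟩ := exists_injective_nat ι
  -- The first coordinate codes the component and the second codes the point within it.
  let f : (Σ i, E i) → ℕ × ℝ := fun M => (enc M.1, embeddingReal (E M.1) M.2)
  refine standardBorelSpace_of_measurableEmbedding (f := f) ⟨?_, ?_, ?_⟩
  · rintro ⟨i, x⟩ ⟨j, y⟩ h
    simp only [f, Prod.mk.injEq] at h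
    obtain ⟨h1, h2⟩ := h
    obtain rfl := henc h1
    rw [(measurableEmbedding_embeddingReal (E i)).injective h2]
  · exact measurable_sigma_iff.2 fun i =>
      (measurable_const (a := enc i)).prodMk (measurable_embeddingReal (E i))
  · intro U hU
    have : f '' U = ⋃ i, {enc i} ×ˢ (embeddingReal (E i) '' (Sigma.mk i ⁻¹' U)) := by
      ext ⟨k, r⟩
      simp only [Set.mem_image, Set.mem_iUnion, Set.mem_prod, Set.mem_singleton_iff, f,
        Prod.mk.injEq, Sigma.exists, Set.mem_preimage]
      constructor
      · rintro ⟨i, x, hx, rfl, rfl⟩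
        exact ⟨i, rfl, x, hx, rfl⟩
      · rintro ⟨i, rfl, x, hx, rfl⟩
        exact ⟨i, x, hx, rfl, rfl⟩
    rw [this]
    exact MeasurableSet.iUnion fun i => (measurableSet_singleton _).prod
      ((measurableEmbedding_embeddingReal (E i)).measurableSet_image'
        (measurableSet_sigma_iff.1 hU i))

end Sigma

/-! ### Borel representatives of trees; the space of trees is standard Borel -/

section Trees

/-- The number of leaves and the partitions of a shape. -/
def TreeShape.data {n : ℕ} (s : TreeShape n) : Σ c : ℕ, Fin (n + 1) → Setoid (Fin c) :=
  ⟨s.card, s.part⟩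

theorem TreeShape.data_injective (n : ℕ) : Function.Injective (TreeShape.data (n := n)) := by
  rintro ⟨c, p, _, _, _⟩ ⟨c', p', _, _, _⟩ h
  simp only [TreeShape.data, Sigma.mk.injEq] at h
  obtain ⟨rfl, h⟩ := h
  simp only [heq_eq_eq] at h
  subst h
  rfl

instance (c : ℕ) : Finite (Setoid (Fin c)) := by
  refine Finite.of_injective (fun s : Setoid (Fin c) => (s.r : Fin c → Fin c → Prop)) ?_
  intro s t h
  ext i j
  exact iff_of_eq (congrFun (congrFun h i) j)

instance (n : ℕ) : Countable (TreeShape n) := (TreeShape.data_injective n).countable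

theorem TreeShape.finite_setOf_card_eq (n k : ℕ) : {s : TreeShape n | s.card = k}.Finite := by
  refine Set.Finite.of_finite_image ((Set.finite_range (Sigma.mk (β := fun c : ℕ =>
    Fin (n + 1) → Setoid (Fin c)) k)).subset ?_) (TreeShape.data_injective n).injOn
  rintro _ ⟨s, rfl, rfl⟩
  exact ⟨s.part, rfl⟩

instance (k : ℕ) : StandardBorelSpace (PosProbVector k) := by
  refine MeasurableSet.standardBorel (α := Fin k → ℝ≥0∞)
    (s := {w | (∀ i, 0 < w i) ∧ ∑ i, w i = 1}) ?_
  refine MeasurableSet.inter ?_ ?_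
  · have : {w : Fin k → ℝ≥0∞ | ∀ i, 0 < w i} = ⋂ i, {w | 0 < w i} := by ext; simp
    change MeasurableSet {w : Fin k → ℝ≥0∞ | ∀ i, 0 < w i}
    rw [this]
    exact MeasurableSet.iInter fun i => measurableSet_lt measurable_const (measurable_pi_apply i)
  · exact measurableSet_eq_fun (Finset.measurable_sum _ fun i _ => measurable_pi_apply i)
      measurable_const

/-- The labelled tree with its leaves renamed. -/
def LabelledTree.relabel {n : ℕ} (s : TreeShape n) (σ : Equiv.Perm (Fin s.card))
    (w : PosProbVector s.card) : LabelledTree n :=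
  ⟨{ card := s.card
     part := fun k => (s.part k).comap σ
     mono := fun _ _ h _ _ hij => s.mono h hij
     part_zero := by
       ext i j
       have : s.part 0 (σ i) (σ j) ↔ i = j := by
         rw [s.part_zero]
         exact σ.injective.eq_iff
       simpa [Setoid.comap_rel] using this
     part_last := by
       ext i j
       have : s.part (Fin.last n) (σ i) (σ j) := by
         rw [s.part_last]
         trivial
       simpa [Setoid.comap_rel] using this },
    ⟨fun i => w.1 (σ i), fun i => w.2.1 _, by rw [Equiv.sum_comp σ w.1]; exact w.2.2⟩⟩

theorem LabelledTree.relabel_iso {n : ℕ} (s : TreeShape n) (σ : Equiv.Perm (Fin s.card))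
    (w : PosProbVector s.card) : LabelledTree.Iso (LabelledTree.relabel s σ w) ⟨s, w⟩ :=
  ⟨σ, fun _ _ _ => Iff.rfl, fun _ => rfl⟩

/-- Isomorphic trees have equally many leaves, so after identifying the leaf sets an isomorphism is
a permutation. Isomorphism classes are therefore finite orbits. -/
theorem LabelledTree.Iso.exists_relabel {n : ℕ} {M N : LabelledTree n} (h : M.Iso N) :
    ∃ σ : Equiv.Perm (Fin N.1.card), M = LabelledTree.relabel N.1 σ N.2 := by
  obtain ⟨e, h1, h2⟩ := h
  obtain ⟨⟨c, p, m, p0, pl⟩, w, hw⟩ := M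
  obtain ⟨⟨c', p', m', p0', pl'⟩, w', hw'⟩ := N
  obtain rfl : c = c' := by simpa using Fintype.card_congr e
  refine ⟨e, ?_⟩
  have hp : p = fun k => (p' k).comap e := by
    funext k
    ext i j
    exact h1 k i j
  have hwe : w = fun i => w' (e i) := funext h2
  clear h1 h2
  change Fin c ≃ Fin c at e
  change p = fun k => (p' k).comap e at hp
  subst hp
  exact congrArg (Sigma.mk (β := fun s : TreeShape n => PosProbVector s.card) _) (Subtype.ext hwe)

theorem LabelledTree.measurable_relabel {n : ℕ} (s : TreeShape n) (σ : Equiv.Perm (Fin s.card)) :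
    Measurable (LabelledTree.relabel s σ) := by
  refine (measurable_sigma_mk (ι := TreeShape n) (E := fun s => PosProbVector s.card) _).comp ?_
  exact (measurable_pi_lambda _ fun i =>
    (measurable_pi_apply (σ i)).comp (measurable_subtype_coe
      (p := fun w : Fin s.card → ℝ≥0∞ => (∀ i, 0 < w i) ∧ ∑ i, w i = 1))).subtype_mk

/-- Measured trees can be labelled in a Borel way. -/
theorem exists_measurable_treeSection (n : ℕ) :
    ∃ s : Tree n → LabelledTree n, Measurable s ∧
      ∀ T, (Quotient.mk _ (s T) : Tree n) = T := by
  obtain ⟨g, hg⟩ := exists_measurableEmbedding_real (LabelledTree n)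
  -- The largest real code in the orbit is an isomorphism invariant, and decoding it returns a
  -- member of the orbit.
  let I : LabelledTree n → ℝ := fun M =>
    Finset.univ.sup' Finset.univ_nonempty fun σ => g (LabelledTree.relabel M.1 σ M.2)
  have hI : Measurable I := by
    refine measurable_sigma_iff.2 fun s => ?_
    have : (fun w => I ⟨s, w⟩) = Finset.univ.sup' Finset.univ_nonempty
        fun σ (w : PosProbVector s.card) => g (LabelledTree.relabel s σ w) := by
      funext w
      rw [Finset.sup'_apply]
    rw [this]
    refine Finset.measurable_sup' Finset.univ_nonempty fun σ _ => ?_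
    exact hg.measurable.comp (LabelledTree.measurable_relabel s σ)
  have hIle : ∀ M N : LabelledTree n, M.Iso N → I M ≤ I N := by
    intro M N h
    refine Finset.sup'_le _ _ fun σ _ => ?_
    have h' : (LabelledTree.relabel M.1 σ M.2).Iso N :=
      (LabelledTree.isoSetoid n).trans (LabelledTree.relabel_iso M.1 σ M.2) h
    obtain ⟨ρ, hρ⟩ := h'.exists_relabel
    rw [hρ]
    exact Finset.le_sup' (fun σ => g (LabelledTree.relabel N.1 σ N.2)) (Finset.mem_univ ρ)
  have hIeq : ∀ M N : LabelledTree n, M.Iso N → I M = I N := fun M N h =>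
    le_antisymm (hIle _ _ h) (hIle _ _ ((LabelledTree.isoSetoid n).symm h))
  let J : Tree n → ℝ := Quotient.lift I hIeq
  have hJ : Measurable J := measurable_from_quotient.2 hI
  have : Nonempty (LabelledTree n) := ⟨LabelledTree.point n⟩
  refine ⟨fun T => hg.invFun (J T), hg.measurable_invFun.comp hJ, fun T => ?_⟩
  induction T using Quotient.inductionOn with
  | h M =>
    obtain ⟨σ, -, hσ⟩ := Finset.exists_mem_eq_sup' (Finset.univ_nonempty)
      fun σ => g (LabelledTree.relabel M.1 σ M.2)
    have : J ⟦M⟧ = g (LabelledTree.relabel M.1 σ M.2) := hσ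
    change (Quotient.mk _ (hg.invFun (J ⟦M⟧)) : Tree n) = _
    rw [this, hg.leftInverse_invFun]
    exact Quotient.sound (LabelledTree.relabel_iso M.1 σ M.2)

/-- A Borel choice of a labelled form of every tree. -/
noncomputable def treeSection (n : ℕ) : Tree n → LabelledTree n :=
  (exists_measurable_treeSection n).choose

theorem measurable_treeSection (n : ℕ) : Measurable (treeSection n) :=
  (exists_measurable_treeSection n).choose_spec.1

@[simp]
theorem mk_treeSection {n : ℕ} (T : Tree n) : (Quotient.mk _ (treeSection n T) : Tree n) = T :=
  (exists_measurable_treeSection n).choose_spec.2 T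

theorem measurable_treeMk (n : ℕ) :
    Measurable fun M : LabelledTree n => (Quotient.mk _ M : Tree n) :=
  fun _ h => h

theorem treeSection_injective (n : ℕ) : Function.Injective (treeSection n) :=
  Function.LeftInverse.injective mk_treeSection

/-- The image of the section is the set of fixed points of the Borel map that replaces a labelled
tree by its canonical form, hence a Borel set. -/
theorem measurableEmbedding_treeSection (n : ℕ) : MeasurableEmbedding (treeSection n) := by
  refine ⟨treeSection_injective n, measurable_treeSection n, fun {U} hU => ?_⟩
  have : treeSection n '' U = {M | treeSection n (Quotient.mk _ M : Tree n) = M} ∩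
      (fun M : LabelledTree n => (Quotient.mk _ M : Tree n)) ⁻¹' U := by
    ext M
    constructor
    · rintro ⟨T, hT, rfl⟩
      simpa using hT
    · rintro ⟨h1, h2⟩
      exact ⟨_, h2, h1⟩
  rw [this]
  exact (measurableSet_eq_fun ((measurable_treeSection n).comp (measurable_treeMk n))
    measurable_id).inter (measurable_treeMk n hU)

instance (n : ℕ) : StandardBorelSpace (Tree n) :=
  standardBorelSpace_of_measurableEmbedding (measurableEmbedding_treeSection n)

end Trees

/-! ### Labellings of finite atomic measures by trees -/

section Labellings

variable {X : Type*} [MeasurableSpace X]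

/-- A countable family of integer valued measurable functions that realizes every labelling of
every finite set. -/
theorem exists_countable_labellings (X : Type*) [MeasurableSpace X] [StandardBorelSpace X] :
    ∃ h : ℕ → X → ℕ, (∀ i, Measurable (h i)) ∧
      ∀ {k : ℕ} (e : Fin k → X), Function.Injective e → ∃ i, ∀ j, h i (e j) = j := by
  obtain ⟨g, hg, hginj⟩ := MeasurableSpace.measurable_injection_nat_bool_of_countablySeparated X
  let H : (Σ m : ℕ, (Fin m → Bool) → ℕ) → X → ℕ := fun q x => q.2 fun i => g x i
  have hH : ∀ q, Measurable (H q) := fun q => by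
    exact (measurable_of_countable q.2).comp
      (measurable_pi_lambda _ fun i => (measurable_pi_apply (i : ℕ)).comp hg)
  obtain ⟨enc, henc⟩ := exists_surjective_nat (Σ m : ℕ, (Fin m → Bool) → ℕ)
  refine ⟨fun i => H (enc i), fun i => hH _, fun {k} e he => ?_⟩
  -- Finitely many distinct points are separated by finitely many binary coordinates, so any
  -- labelling of them is a function of a finite binary word; there are only countably many words
  -- with prescribed labels that matter, encoded by the function extended by zero.
  have hsep : ∃ m : ℕ, Function.Injective fun (j : Fin k) (i : Fin m) => g (e j) i := by
    have : ∀ p : Fin k × Fin k, ∃ m : ℕ, p.1 ≠ p.2 → g (e p.1) m ≠ g (e p.2) m := by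
      rintro ⟨a, b⟩
      by_cases hab : a = b
      · exact ⟨0, fun h => absurd hab h⟩
      · obtain ⟨m, hm⟩ := Function.ne_iff.1 fun h => hab (he (hginj h))
        exact ⟨m, fun _ => hm⟩
    choose m hm using this
    refine ⟨Finset.univ.sup m + 1, fun a b hab => ?_⟩
    by_contra hne
    refine hm (a, b) hne (congrFun hab ⟨m (a, b), ?_⟩)
    exact Nat.lt_succ_of_le (Finset.le_sup (Finset.mem_univ _))
  obtain ⟨m, hm⟩ := hsep
  obtain ⟨i, hi⟩ := henc ⟨m, fun v => Function.extend
    (fun (j : Fin k) (i : Fin m) => g (e j) i) (fun j => (j : ℕ)) 0 v⟩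
  refine ⟨i, fun j => ?_⟩
  simp only [H, hi]
  exact hm.extend_apply _ _ j

/-- A measure without mass on pairs of distinct points is a point mass. -/
theorem exists_measure_compl_singleton_eq_zero (ρ : Measure X) [SFinite ρ] (h0 : ρ ≠ 0)
    (h : (ρ.prod ρ) {p | p.1 ≠ p.2} = 0) : ∃ x, ρ {x}ᶜ = 0 := by
  have := Measure.measure_ae_null_of_prod_null h
  have hne : (ae ρ).NeBot := ae_neBot.2 h0
  obtain ⟨x, hx⟩ := this.exists
  refine ⟨x, ?_⟩
  have hset : Prod.mk x ⁻¹' {p : X × X | p.1 ≠ p.2} = {x}ᶜ := by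
    ext y
    simp [eq_comm]
  rw [← hset]
  exact hx

/-- The map `e` labels the atoms of `ρ` by the leaves of `M`, in accordance with the equivalence
relations given by the functions `f k`. -/
structure IsLabelling {n : ℕ} (f : Fin (n + 1) → X → ℝ) (ρ : Measure X) (M : LabelledTree n)
    (e : Fin M.1.card → X) : Prop where
  injective : Function.Injective e
  range_eq : Set.range e = {y | 0 < ρ {y}}
  mass_eq : ∀ i, M.mass i = ρ {e i}
  part_iff : ∀ k i j, M.1.part k i j ↔ f k (e i) = f k (e j)

namespace IsLabelling

variable {n : ℕ} {f : Fin (n + 1) → X → ℝ} {ρ : Measure X} {M N : LabelledTree n}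
  {e : Fin M.1.card → X} {e' : Fin N.1.card → X}

/-- Both labellings enumerate the same set of atoms; composing one with the inverse of the other
matches the leaves. -/
theorem iso (h : IsLabelling f ρ M e) (h' : IsLabelling f ρ N e') : M.Iso N := by
  let E := (Equiv.ofInjective e h.injective).trans
    ((Equiv.setCongr (h.range_eq.trans h'.range_eq.symm)).trans
      (Equiv.ofInjective e' h'.injective).symm)
  have hE : ∀ i, e' (E i) = e i := fun i => by
    simp [E, Equiv.apply_ofInjective_symm]
  exact ⟨E, fun k i j => by rw [h.part_iff, h'.part_iff, hE, hE],
    fun i => by rw [h.mass_eq, h'.mass_eq, hE]⟩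

theorem of_iso (h : IsLabelling f ρ M e) (hMN : M.Iso N) : ∃ e', IsLabelling f ρ N e' := by
  obtain ⟨σ, h1, h2⟩ := hMN
  refine ⟨e ∘ σ.symm, h.injective.comp σ.symm.injective, ?_, fun i => ?_, fun k i j => ?_⟩
  · rw [σ.symm.surjective.range_comp, h.range_eq]
  · have := h2 (σ.symm i)
    rw [σ.apply_symm_apply] at this
    rw [← this, h.mass_eq]
    rfl
  · have := h1 k (σ.symm i) (σ.symm j)
    rw [σ.apply_symm_apply, σ.apply_symm_apply] at this
    rw [← this, h.part_iff]
    rfl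

theorem forall_of_ae (h : IsLabelling f ρ M e) {p : X → Prop} (hp : ∀ᵐ x ∂ρ, p x)
    (i : Fin M.1.card) : p (e i) := by
  by_contra hne
  have : e i ∈ {y | 0 < ρ {y}} := h.range_eq ▸ Set.mem_range_self i
  exact (this : 0 < ρ {e i}).ne' (measure_mono_null (Set.singleton_subset_iff.2 hne) hp)

theorem measure_compl_range [MeasurableSingletonClass X] [IsProbabilityMeasure ρ]
    (h : IsLabelling f ρ M e) : ρ (Set.range e)ᶜ = 0 := by
  have hfin : (Set.range e).Finite := Set.finite_range e
  rw [prob_compl_eq_zero_iff hfin.measurableSet]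
  have : Set.range e = ⋃ i, {e i} := by ext; simp [eq_comm]
  rw [this, measure_iUnion, tsum_fintype, ← M.2.2.2]
  · exact Finset.sum_congr rfl fun i _ => (h.mass_eq i).symm
  · intro i j hij
    simpa using h.injective.ne hij
  · exact fun i => measurableSet_singleton _

end IsLabelling

end Labellings

/-! ### Measurable selection of a labelling -/

section LabelSelection

variable {X Y : Type*} [MeasurableSpace X] [MeasurableSpace Y] {n : ℕ}

/-- The labelled tree with a given shape whose masses are the measures of the level sets of the
labelling `h`. -/
noncomputable def treeOfLabels (s : TreeShape n) (h : X → ℕ) (ρ : Measure X) : LabelledTree n :=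
  open Classical in
  if H : (∀ i : Fin s.card, 0 < ρ (h ⁻¹' {(i : ℕ)})) ∧ ∑ i : Fin s.card, ρ (h ⁻¹' {(i : ℕ)}) = 1
  then ⟨s, ⟨fun i => ρ (h ⁻¹' {(i : ℕ)}), H⟩⟩ else LabelledTree.point n

theorem measurable_treeOfLabels (s : TreeShape n) {h : X → ℕ} (hh : Measurable h)
    (K : Kernel Y X) : Measurable fun y => treeOfLabels s h (K y) := by
  classical
  have h1 : ∀ S : Set X, MeasurableSet S → Measurable fun y => K y S := fun S hS =>
    Kernel.measurable_coe _ hS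
  have hi : ∀ i : ℕ, MeasurableSet (h ⁻¹' {i}) := fun i => hh (measurableSet_singleton i)
  refine Measurable.dite (s := {y | (∀ i : Fin s.card, 0 < K y (h ⁻¹' {(i : ℕ)})) ∧
    ∑ i : Fin s.card, K y (h ⁻¹' {(i : ℕ)}) = 1}) (f := fun y =>
    (⟨s, ⟨fun i => K y (h ⁻¹' {(i : ℕ)}), y.2⟩⟩ : LabelledTree n))
    (g := fun _ => LabelledTree.point n) ?_ measurable_const ?_
  · refine (measurable_sigma_mk (ι := TreeShape n) (E := fun s => PosProbVector s.card) s).comp ?_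
    exact (measurable_pi_lambda _ fun (i : Fin s.card) => (h1 _ (hi i)).comp measurable_subtype_coe).subtype_mk
  · simp only [Set.ofPred_and, Set.ofPred_forall]
    exact (MeasurableSet.iInter fun i : Fin s.card =>
      measurableSet_lt measurable_const (h1 _ (hi i))).inter (measurableSet_eq_fun
        (Finset.measurable_sum _ fun (i : Fin s.card) _ => h1 _ (hi i)) measurable_const)

variable [StandardBorelSpace X]

/-- The labelling `h` separates the atoms of `ρ` and turns them into a tree of shape `s`. -/
def IsGoodLabel (f : Fin (n + 1) → X → ℝ) (s : TreeShape n) (h : X → ℕ) (ρ : Measure X) : Prop :=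
  ((∀ i : Fin s.card, 0 < ρ (h ⁻¹' {(i : ℕ)})) ∧ ∑ i : Fin s.card, ρ (h ⁻¹' {(i : ℕ)}) = 1) ∧
  (∀ i : Fin s.card, (ρ.prod ρ) {p | (h p.1 = i ∧ h p.2 = i) ∧ p.1 ≠ p.2} = 0) ∧
  ∀ (k : Fin (n + 1)) (i j : Fin s.card),
    (ρ.prod ρ) {p | (h p.1 = i ∧ h p.2 = j) ∧ ¬ (s.part k i j ↔ f k p.1 = f k p.2)} = 0

/-- Goodness is phrased through masses and null sets of `ρ.prod ρ` rather than through the atoms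
themselves, so that it depends measurably on the parameter of a kernel. -/
theorem measurableSet_isGoodLabel {f : Fin (n + 1) → X → ℝ} (hf : ∀ k, Measurable (f k))
    (s : TreeShape n) {h : X → ℕ} (hh : Measurable h) (K : Kernel Y X) [IsFiniteKernel K] :
    MeasurableSet {y | IsGoodLabel f s h (K y)} := by
  have h1 : ∀ S : Set X, MeasurableSet S → Measurable fun y => K y S := fun S hS =>
    Kernel.measurable_coe _ hS
  have h2 : ∀ S : Set (X × X), MeasurableSet S → MeasurableSet {y | ((K y).prod (K y)) S = 0} :=
    fun S hS => by
      have : ∀ y, ((K y).prod (K y)) S = (K ×ₖ K) y S := fun y => by rw [Kernel.prod_apply]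
      simp only [this]
      exact Kernel.measurable_coe _ hS (measurableSet_singleton 0)
  have hi : ∀ i : ℕ, MeasurableSet (h ⁻¹' {i}) := fun i => hh (measurableSet_singleton i)
  have hpre : ∀ i j : ℕ, MeasurableSet {p : X × X | h p.1 = i ∧ h p.2 = j} := fun i j =>
    (measurable_fst (hi i)).inter (measurable_snd (hi j))
  simp only [IsGoodLabel, Set.ofPred_and, Set.ofPred_forall]
  refine ((MeasurableSet.iInter fun i : Fin s.card =>
    measurableSet_lt measurable_const (h1 _ (hi i))).inter (measurableSet_eq_fun
      (Finset.measurable_sum _ fun (i : Fin s.card) _ => h1 _ (hi i)) measurable_const)).inter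
    ((MeasurableSet.iInter fun i => h2 _ ?_).inter
      (MeasurableSet.iInter fun k => MeasurableSet.iInter fun i => MeasurableSet.iInter fun j =>
        h2 _ ?_))
  · exact (hpre i i).inter (measurableSet_eq_fun measurable_fst measurable_snd).compl
  · refine (hpre i j).inter (MeasurableSet.compl ?_)
    have hk : MeasurableSet {p : X × X | f k p.1 = f k p.2} :=
      measurableSet_eq_fun ((hf k).comp measurable_fst) ((hf k).comp measurable_snd)
    change MeasurableSet {p : X × X | s.part k i j ↔ f k p.1 = f k p.2}
    by_cases hp : s.part k i j
    · simp only [hp, true_iff]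
      exact hk
    · simp only [hp, false_iff]
      exact hk.compl

/-- A level set whose square is null off the diagonal carries a single atom. Pairs of atoms have
positive product mass, so the almost sure conditions on pairs hold for the atoms themselves. -/
theorem IsGoodLabel.exists_isLabelling {f : Fin (n + 1) → X → ℝ} {s : TreeShape n} {h : X → ℕ}
    {ρ : Measure X} [IsProbabilityMeasure ρ] (hh : Measurable h) (H : IsGoodLabel f s h ρ) :
    ∃ e, IsLabelling f ρ (treeOfLabels s h ρ) e ∧ ∀ i, h (e i) = i := by
  obtain ⟨H1, H2, H3⟩ := H
  have hi : ∀ i : ℕ, MeasurableSet (h ⁻¹' {i}) := fun i => hh (measurableSet_singleton i)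
  rw [treeOfLabels, dif_pos H1]
  have hpt : ∀ i : Fin s.card, ∃ x, h x = i ∧ ρ {x} = ρ (h ⁻¹' {(i : ℕ)}) := by
    intro i
    have hr : ρ.restrict (h ⁻¹' {(i : ℕ)}) ≠ 0 := by
      rw [Ne, Measure.restrict_eq_zero]
      exact (H1.1 i).ne'
    obtain ⟨x, hx⟩ := exists_measure_compl_singleton_eq_zero _ hr (by
      rw [Measure.prod_restrict, Measure.restrict_apply
        (s := (h ⁻¹' {(i : ℕ)}) ×ˢ (h ⁻¹' {(i : ℕ)})) (t := {p : X × X | p.1 ≠ p.2})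
        (measurableSet_eq_fun measurable_fst measurable_snd).compl]
      convert H2 i using 2
      ext p
      simp [and_comm])
    rw [Measure.restrict_apply (measurableSet_singleton x).compl] at hx
    have hxi : h x = i := by
      by_contra hne
      have : {x}ᶜ ∩ h ⁻¹' {(i : ℕ)} = h ⁻¹' {(i : ℕ)} := by
        ext y
        simp only [Set.mem_inter_iff, Set.mem_compl_iff, Set.mem_singleton_iff, Set.mem_preimage,
          and_iff_right_iff_imp]
        rintro hy rfl
        exact hne hy
      rw [this] at hx
      exact (H1.1 i).ne' hx
    refine ⟨x, hxi, ?_⟩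
    refine le_antisymm (measure_mono (by simpa using hxi)) ?_
    calc ρ (h ⁻¹' {(i : ℕ)}) ≤ ρ ({x} ∪ ({x}ᶜ ∩ h ⁻¹' {(i : ℕ)})) :=
          measure_mono fun y hy => by
            by_cases hyx : y = x
            · exact Or.inl hyx
            · exact Or.inr ⟨hyx, hy⟩
      _ ≤ ρ {x} + 0 := hx ▸ measure_union_le _ _
      _ = ρ {x} := add_zero _
  choose e he1 he2 using hpt
  have hinj : Function.Injective e := fun i j hij => by
    have := he1 i
    rw [hij, he1 j] at this
    exact Fin.ext this.symm
  refine ⟨e, ⟨hinj, ?_, fun i => (he2 i).symm, fun k i j => ?_⟩, he1⟩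
  · have hsum : ρ (Set.range e) = 1 := by
      have : Set.range e = ⋃ i, {e i} := by ext; simp [eq_comm]
      rw [this, measure_iUnion, tsum_fintype, ← H1.2]
      · exact Finset.sum_congr rfl fun i _ => he2 i
      · intro i j hij
        simpa using hinj.ne hij
      · exact fun i => measurableSet_singleton _
    ext x
    constructor
    · rintro ⟨i, rfl⟩
      change 0 < ρ {e i}
      rw [he2]
      exact H1.1 i
    · intro hx
      by_contra hne
      have h0 : ρ (Set.range e)ᶜ = 0 :=
        (prob_compl_eq_zero_iff (Set.finite_range e).measurableSet).2 hsum
      exact (hx : 0 < ρ {x}).ne' (measure_mono_null (by simpa using hne) h0)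
  · by_contra hne
    have := H3 k i j
    have hle : (ρ.prod ρ) ({e i} ×ˢ {e j}) ≤ 0 := by
      rw [← this]
      refine measure_mono ?_
      rintro ⟨a, b⟩ ⟨ha, hb⟩
      simp only [Set.mem_singleton_iff] at ha hb
      subst ha hb
      exact ⟨⟨he1 i, he1 j⟩, hne⟩
    rw [Measure.prod_prod, he2, he2] at hle
    exact absurd hle (not_le.2 (ENNReal.mul_pos (H1.1 i).ne' (H1.1 j).ne'))

theorem IsLabelling.isGoodLabel {f : Fin (n + 1) → X → ℝ} {M : LabelledTree n} {h : X → ℕ}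
    {ρ : Measure X} [IsProbabilityMeasure ρ] {e : Fin M.1.card → X} (H : IsLabelling f ρ M e)
    (he : ∀ i, h (e i) = i) : IsGoodLabel f M.1 h ρ ∧ treeOfLabels M.1 h ρ = M := by
  have hnull := H.measure_compl_range
  have hae : ∀ᵐ x ∂ρ, x ∈ Set.range e := hnull
  have hmass : ∀ i : Fin M.1.card, ρ (h ⁻¹' {(i : ℕ)}) = M.mass i := fun i => by
    rw [H.mass_eq]
    refine measure_congr ?_
    filter_upwards [hae]
    rintro _ ⟨j, rfl⟩
    refine propext ⟨fun hj => ?_, fun hj => ?_⟩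
    · have hj : h (e j) = i := hj
      rw [he] at hj
      rw [Fin.ext hj]
      rfl
    · have hj : e j = e i := hj
      change h (e j) = i
      rw [hj, he]
  have hprod : ∀ᵐ p ∂(ρ.prod ρ), p.1 ∈ Set.range e ∧ p.2 ∈ Set.range e :=
    (Measure.quasiMeasurePreserving_fst.ae hae).and (Measure.quasiMeasurePreserving_snd.ae hae)
  have H1 : (∀ i : Fin M.1.card, 0 < ρ (h ⁻¹' {(i : ℕ)})) ∧
      ∑ i : Fin M.1.card, ρ (h ⁻¹' {(i : ℕ)}) = 1 := by
    simp only [hmass]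
    exact M.2.2
  refine ⟨⟨H1, fun i => ?_, fun k i j => ?_⟩, ?_⟩
  · refine measure_mono_null ?_ hprod
    rintro ⟨_, _⟩ ⟨⟨h1, h2⟩, h3⟩ ⟨⟨a, rfl⟩, ⟨b, rfl⟩⟩
    simp only [he] at h1 h2
    exact h3 (congrArg e (Fin.ext (h1.trans h2.symm)))
  · refine measure_mono_null ?_ hprod
    rintro ⟨_, _⟩ ⟨⟨h1, h2⟩, h3⟩ ⟨⟨a, rfl⟩, ⟨b, rfl⟩⟩
    simp only [he] at h1 h2
    obtain rfl := Fin.ext h1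
    obtain rfl := Fin.ext h2
    exact h3 (H.part_iff k _ _)
  · rw [treeOfLabels, dif_pos H1]
    obtain ⟨s, w, hw⟩ := M
    exact congrArg (Sigma.mk (β := fun s : TreeShape n => PosProbVector s.card) s)
      (Subtype.ext (funext hmass))

/-- A measurable family of finite atomic measures can be labelled measurably by the canonical forms
of the corresponding trees. -/
theorem exists_measurable_labelling {f : Fin (n + 1) → X → ℝ} (hf : ∀ k, Measurable (f k))
    (K : Kernel Y X) [IsMarkovKernel K] :
    ∃ (T : Y → Tree n) (lab : Y × X → ℕ), Measurable T ∧ Measurable lab ∧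
      ∀ y, (∃ M e, IsLabelling f (K y) M e) →
        ∃ e, IsLabelling f (K y) (treeSection n (T y)) e ∧ ∀ i, lab (y, e i) = i := by
  classical
  obtain ⟨h, hh, hlab⟩ := exists_countable_labellings X
  have : Nonempty (TreeShape n) := ⟨(LabelledTree.point n).1⟩
  obtain ⟨enc, henc⟩ := exists_surjective_nat (TreeShape n × ℕ)
  let S : Y → ℕ → LabelledTree n := fun y i => treeOfLabels (enc i).1 (h (enc i).2) (K y)
  have hS : ∀ i, Measurable fun y => S y i := fun i => measurable_treeOfLabels _ (hh _) K
  -- The second clause demands that the labelled tree obtained is the canonical form of its class,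
  -- so that the numbering refers to `treeSection`.
  let P : Y → ℕ → Prop := fun y i => IsGoodLabel f (enc i).1 (h (enc i).2) (K y) ∧
    treeSection n (Quotient.mk _ (S y i)) = S y i
  have hP : ∀ i, MeasurableSet {y | P y i} := fun i =>
    (measurableSet_isGoodLabel hf _ (hh _) K).inter (measurableSet_eq_fun
      ((measurable_treeSection n).comp ((measurable_treeMk n).comp (hS i))) (hS i))
  -- The alternative clause makes every index admissible where no good one exists, so that the
  -- search for the least index is total.
  let Q : Y → ℕ → Prop := fun y i => P y i ∨ ∀ j, ¬ P y j
  have hQ : ∀ i, MeasurableSet {y | Q y i} := fun i => by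
    refine (hP i).union ?_
    change MeasurableSet {y | ∀ j, ¬ P y j}
    simp only [Set.ofPred_forall]
    exact MeasurableSet.iInter fun j => (hP j).compl
  have hQex : ∀ y, ∃ i, Q y i := fun y => by
    by_cases hy : ∃ i, P y i
    · exact ⟨hy.choose, Or.inl hy.choose_spec⟩
    · exact ⟨0, Or.inr (not_exists.1 hy)⟩
  let N : Y → ℕ := fun y => Nat.find (hQex y)
  have hN : Measurable N := measurable_find hQex hQ
  refine ⟨fun y => Quotient.mk _ (S y (N y)), fun p => h (enc (N p.1)).2 p.2, ?_, ?_, ?_⟩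
  · refine (measurable_treeMk n).comp ?_
    exact (measurable_from_prod_countable_left (f := fun p : Y × ℕ => S p.1 p.2) hS).comp
      (measurable_id.prodMk hN)
  · have hm : Measurable fun p : X × ℕ => h (enc p.2).2 p.1 :=
      measurable_from_prod_countable_left (f := fun p : X × ℕ => h (enc p.2).2 p.1)
        fun i => hh (enc i).2
    exact hm.comp (measurable_snd.prodMk (hN.comp measurable_fst))
  · rintro y ⟨M, e, he⟩
    have hiso : M.Iso (treeSection n (Quotient.mk _ M)) :=
      Quotient.exact (s := LabelledTree.isoSetoid n) (mk_treeSection _).symm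
    obtain ⟨M', hM'⟩ : ∃ M', M' = treeSection n (Quotient.mk _ M) := ⟨_, rfl⟩
    rw [← hM'] at hiso
    obtain ⟨e', he'⟩ := he.of_iso hiso
    obtain ⟨i, hi⟩ := hlab e' he'.injective
    obtain ⟨j, hj⟩ := henc (M'.1, i)
    have hPj : P y j := by
      have h1 : (enc j).1 = M'.1 := by rw [hj]
      have h2 : (enc j).2 = i := by rw [hj]
      have := he'.isGoodLabel hi
      refine ⟨by rw [h1, h2]; exact this.1, ?_⟩
      have hSM : S y j = M' := by
        simp only [S, h1, h2]
        exact this.2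
      rw [hSM, hM', mk_treeSection]
    have hPN : P y (N y) := by
      rcases Nat.find_spec (hQex y) with h | h
      · exact h
      · exact absurd hPj (h j)
    obtain ⟨e'', h1, h2⟩ := hPN.1.exists_isLabelling (hh _)
    have hc := hPN.2
    change ∃ e, IsLabelling f (K y) (treeSection n (Quotient.mk _ (S y (N y)))) e ∧
      ∀ i, h (enc (N y)).2 (e i) = i
    rw [hc]
    exact ⟨e'', h1, h2⟩

end LabelSelection

/-! ### Distribution functions of atomless measures on the line -/

section Distribution

/-- The points that are not separated from `r` on the left by a measure form a null set. -/
theorem measure_setOf_measure_Ioc_eq_zero (ρ : Measure ℝ) [NullSingletonClass ρ] (r : ℝ) :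
    ρ {q | r < q ∧ ρ (Set.Ioc r q) = 0} = 0 := by
  set E := {q | r < q ∧ ρ (Set.Ioc r q) = 0} with hE
  have hdown : ∀ q ∈ E, ∀ p, r < p → p ≤ q → p ∈ E := fun q hq p hp hpq =>
    ⟨hp, measure_mono_null (Set.Ioc_subset_Ioc_right hpq) hq.2⟩
  -- `E` is closed downwards within the points above `r`: it is covered by countably many null
  -- intervals with rational endpoint, together with its maximum if there is one.
  have hsub : E ⊆ (⋃ p : {p : ℚ // (p : ℝ) ∈ E}, Set.Ioc r (p : ℝ)) ∪ {q ∈ E | ∀ p ∈ E, p ≤ q} := by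
    intro q hq
    by_cases hmax : ∀ p ∈ E, p ≤ q
    · exact Or.inr ⟨hq, hmax⟩
    · push Not at hmax
      obtain ⟨p, hp, hqp⟩ := hmax
      obtain ⟨t, hqt, htp⟩ := exists_rat_btwn hqp
      exact Or.inl (Set.mem_iUnion.2 ⟨⟨t, hdown p hp t (hq.1.trans hqt) htp.le⟩, hq.1, hqt.le⟩)
  refine measure_mono_null hsub (measure_union_null
    (measure_iUnion_null fun p => p.2.2) (Set.Subsingleton.measure_zero ?_ ρ))
  exact fun a ha b hb => le_antisymm (hb.2 a ha.1) (ha.2 b hb.1)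

/-- Without atoms the distribution function has no jumps. Its sublevel set at `u` is a half-line
with some endpoint `r`, up to that endpoint; the mass on the left of `r` is at most `u` and the mass
on the right at most the total minus `u`, which forces equality. -/
theorem measure_setOf_measure_Iic_le (ρ : Measure ℝ) [IsFiniteMeasure ρ] [NullSingletonClass ρ]
    (u : ℝ≥0∞) : ρ {q | ρ (Set.Iic q) ≤ u} = min u (ρ Set.univ) := by
  set E := {q | ρ (Set.Iic q) ≤ u} with hE
  have hdown : ∀ q ∈ E, ∀ p, p ≤ q → p ∈ E := fun q hq p hpq =>
    (measure_mono (Set.Iic_subset_Iic.2 hpq)).trans hq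
  rcases le_or_gt (ρ Set.univ) u with hu | hu
  · have : E = Set.univ := Set.eq_univ_of_forall fun q => (measure_mono (Set.subset_univ _)).trans hu
    rw [this, min_eq_right hu]
  rw [min_eq_left hu.le]
  rcases Set.eq_empty_or_nonempty E with h0 | hne
  · rw [h0, measure_empty]
    by_contra hu0
    have hpos : 0 < u := pos_iff_ne_zero.2 fun h => hu0 h.symm
    -- Points far to the left have arbitrarily little mass before them, so an empty sublevel set is
    -- possible only for `u = 0`.
    have hlim := tendsto_measure_Ici_atBot ρ
    obtain ⟨q, hq⟩ := (hlim.eventually (lt_mem_nhds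
      (ENNReal.sub_lt_self (measure_ne_top ρ _) hu.ne_bot hpos.ne'))).exists
    have : q - 1 ∈ E := by
      refine (measure_mono (t := (Set.Ici q)ᶜ) fun p hp => ?_).trans ?_
      · rw [Set.compl_Ici]
        exact lt_of_le_of_lt hp (sub_one_lt q)
      · rw [measure_compl measurableSet_Ici (measure_ne_top _ _)]
        exact tsub_le_iff_tsub_le.1 hq.le
    rw [h0] at this
    exact this
  have hbdd : BddAbove E := by
    have hlim := tendsto_measure_Iic_atTop ρ
    obtain ⟨q, hq⟩ := (hlim.eventually (lt_mem_nhds hu)).exists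
    exact ⟨q, fun p hp => le_of_not_gt fun hqp => absurd (hdown p hp q hqp.le) (not_le.2 hq)⟩
  set r := sSup E
  have hlt : ∀ q, q < r → q ∈ E := fun q hq => by
    obtain ⟨p, hp, hqp⟩ := exists_lt_of_lt_csSup hne hq
    exact hdown p hp q hqp.le
  have hgt : ∀ q, r < q → u < ρ (Set.Iic q) := fun q hq => by
    by_contra h
    exact absurd (le_csSup hbdd (not_lt.1 h : q ∈ E)) (not_le.2 hq)
  have hE1 : ρ E = ρ (Set.Iio r) := by
    refine le_antisymm ?_ (measure_mono hlt)
    calc ρ E ≤ ρ (Set.Iic r) := measure_mono fun q hq => le_csSup hbdd hq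
      _ = ρ (Set.Iio r) := measure_congr Iio_ae_eq_Iic.symm
  have h1 : ρ (Set.Iio r) ≤ u := by
    obtain ⟨v, hv, hvr, hvt⟩ := exists_seq_strictMono_tendsto r
    rw [← iUnion_Iic_eq_Iio_of_lt_of_tendsto hvr hvt, Monotone.measure_iUnion
      fun i j hij => Set.Iic_subset_Iic.2 (hv.monotone hij)]
    exact iSup_le fun i => hlt _ (hvr i)
  have h2 : ρ (Set.Ioi r) ≤ ρ Set.univ - u := by
    obtain ⟨v, hv, hvr, hvt⟩ := exists_seq_strictAnti_tendsto r
    rw [← iUnion_Ici_eq_Ioi_of_lt_of_tendsto hvr hvt, Monotone.measure_iUnion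
      fun i j hij => Set.Ici_subset_Ici.2 (hv.antitone hij)]
    refine iSup_le fun i => ?_
    rw [← measure_congr (Ioi_ae_eq_Ici (μ := ρ)), ← Set.compl_Iic, measure_compl measurableSet_Iic (measure_ne_top _ _)]
    exact tsub_le_tsub_left (hgt _ (hvr i)).le _
  rw [hE1]
  refine le_antisymm h1 ?_
  have h3 : ρ Set.univ = ρ (Set.Iio r) + ρ (Set.Ioi r) := by
    rw [← measure_union (show Disjoint (Set.Iio r) (Set.Ioi r) from
      Set.disjoint_left.2 fun x (hx : x < r) (hx' : r < x) => lt_asymm hx hx') measurableSet_Ioi]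
    refine measure_congr ?_
    filter_upwards [Measure.ae_ne ρ r] with x hx
    exact propext ⟨fun _ => lt_or_gt_of_ne hx, fun _ => trivial⟩
  by_contra hlt'
  rw [not_le] at hlt'
  have : ρ (Set.Iio r) + ρ (Set.Ioi r) < u + (ρ Set.univ - u) :=
    ENNReal.add_lt_add_of_lt_of_le (measure_ne_top _ _) hlt' h2
  rw [← h3, add_tsub_cancel_of_le hu.le] at this
  exact lt_irrefl _ this

theorem measurable_measure_Iic (ρ : Measure ℝ) : Measurable fun q => ρ (Set.Iic q) :=
  Monotone.measurable fun _ _ h => measure_mono (Set.Iic_subset_Iic.2 h)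

/-- The distribution function of an atomless measure takes it to a measure that only depends on the
total mass. -/
theorem map_measure_Iic_eq (ρ ρ' : Measure ℝ) [IsFiniteMeasure ρ] [NullSingletonClass ρ]
    [IsFiniteMeasure ρ'] [NullSingletonClass ρ'] (h : ρ Set.univ = ρ' Set.univ) :
    ρ.map (fun q => ρ (Set.Iic q)) = ρ'.map fun q => ρ' (Set.Iic q) := by
  refine Measure.ext_of_Iic _ _ fun u => ?_
  rw [Measure.map_apply (measurable_measure_Iic ρ) measurableSet_Iic,
    Measure.map_apply (measurable_measure_Iic ρ') measurableSet_Iic]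
  change ρ {q | ρ (Set.Iic q) ≤ u} = ρ' {q | ρ' (Set.Iic q) ≤ u}
  rw [measure_setOf_measure_Iic_le, measure_setOf_measure_Iic_le, h]

end Distribution

/-! ### The mass–rank coordinate and its almost injectivity -/

section MassRank

/-- The mass of a point together with the mass of the points of the same mass on its left. -/
noncomputable def massRank (η : Measure ℝ) (r : ℝ) : ℝ≥0∞ × ℝ≥0∞ :=
  (η {r}, η {q | η {q} = η {r} ∧ q ≤ r})

variable {α : Type*} [MeasurableSpace α]

theorem measurable_kernel_singleton (K : Kernel α ℝ) [IsSFiniteKernel K] :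
    Measurable fun p : α × ℝ => K p.1 {p.2} := by
  have hm : MeasurableSet {q : (α × ℝ) × ℝ | q.2 = q.1.2} :=
    measurableSet_eq_fun measurable_snd (measurable_snd.comp measurable_fst)
  exact Kernel.measurable_kernel_prodMk_left (κ := K.prodMkRight ℝ) hm

theorem measurable_kernel_massRank (K : Kernel α ℝ) [IsSFiniteKernel K] :
    Measurable fun p : α × ℝ => massRank (K p.1) p.2 := by
  have h1 := measurable_kernel_singleton K
  refine h1.prodMk ?_
  have hm : MeasurableSet {q : (α × ℝ) × ℝ | K q.1.1 {q.2} = K q.1.1 {q.1.2} ∧ q.2 ≤ q.1.2} := by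
    refine MeasurableSet.inter ?_ ?_
    · exact measurableSet_eq_fun
        (h1.comp ((measurable_fst.comp measurable_fst).prodMk measurable_snd))
        (h1.comp measurable_fst)
    · exact measurableSet_le measurable_snd (measurable_snd.comp measurable_fst)
  exact Kernel.measurable_kernel_prodMk_left (κ := K.prodMkRight ℝ) hm

theorem measurable_massRank (η : Measure ℝ) [SFinite η] : Measurable (massRank η) :=
  (measurable_kernel_massRank (Kernel.const Unit η)).comp (measurable_const.prodMk measurable_id
    : Measurable fun r : ℝ => ((), r))

theorem measurable_measure_singleton (η : Measure ℝ) [SFinite η] : Measurable fun r => η {r} :=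
  (measurable_massRank η).fst

/-- The points where the distribution function of the atomless part does not increase. -/
def IsFlat (η : Measure ℝ) (r : ℝ) : Prop :=
  η {r} = 0 ∧ ∃ q : ℚ, (q : ℝ) < r ∧ η {p | η {p} = 0 ∧ (q : ℝ) < p ∧ p ≤ r} = 0

theorem measurableSet_isFlat (K : Kernel α ℝ) [IsSFiniteKernel K] :
    MeasurableSet {p : α × ℝ | IsFlat (K p.1) p.2} := by
  have h1 := measurable_kernel_singleton K
  simp only [IsFlat, Set.ofPred_and, Set.ofPred_exists]
  refine (h1 (measurableSet_singleton 0)).inter (MeasurableSet.iUnion fun q =>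
    (measurableSet_lt measurable_const measurable_snd).inter ?_)
  have hm : MeasurableSet {p : (α × ℝ) × ℝ | K p.1.1 {p.2} = 0 ∧ (q : ℝ) < p.2 ∧ p.2 ≤ p.1.2} := by
    refine MeasurableSet.inter ?_ (MeasurableSet.inter ?_ ?_)
    · exact (h1.comp ((measurable_fst.comp measurable_fst).prodMk measurable_snd))
        (measurableSet_singleton 0)
    · exact measurableSet_lt measurable_const measurable_snd
    · exact measurableSet_le measurable_snd (measurable_snd.comp measurable_fst)
  exact (Kernel.measurable_kernel_prodMk_left (κ := K.prodMkRight ℝ) hm) (measurableSet_singleton 0)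

/-- The atomless part of a measure. -/
noncomputable def contPart (η : Measure ℝ) : Measure ℝ := η.restrict {r | η {r} = 0}

theorem measurableSet_null_singleton (η : Measure ℝ) [SFinite η] :
    MeasurableSet {r | η {r} = 0} :=
  measurable_measure_singleton η (measurableSet_singleton 0)

instance (η : Measure ℝ) [IsFiniteMeasure η] : IsFiniteMeasure (contPart η) := by
  unfold contPart
  infer_instance

instance (η : Measure ℝ) [IsFiniteMeasure η] : NullSingletonClass (contPart η) := by
  refine ⟨fun r => ?_⟩
  rw [contPart, Measure.restrict_apply (measurableSet_singleton r)]
  by_cases hr : η {r} = 0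
  · exact measure_mono_null Set.inter_subset_left hr
  · have : {r} ∩ {r | η {r} = 0} = ∅ := by
      ext q
      simp only [Set.mem_inter_iff, Set.mem_singleton_iff, Set.mem_ofPred_eq,
        Set.mem_empty_iff_false, iff_false, not_and]
      rintro rfl
      exact hr
    rw [this, measure_empty]

/-- For each rational `q`, the points to the right of `q` that are reached without gaining atomless
mass are null for the atomless part; rational endpoints make the union countable. -/
theorem measure_isFlat (η : Measure ℝ) [IsFiniteMeasure η] : η {r | IsFlat η r} = 0 := by
  have hsub : {r | IsFlat η r} ⊆ ⋃ q : ℚ,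
      {r | (q : ℝ) < r ∧ contPart η (Set.Ioc (q : ℝ) r) = 0} ∩ {r | η {r} = 0} := by
    rintro r ⟨h0, q, hq, hq'⟩
    refine Set.mem_iUnion.2 ⟨q, ⟨hq, ?_⟩, h0⟩
    rw [contPart, Measure.restrict_apply measurableSet_Ioc]
    exact measure_mono_null (fun p hp => by exact ⟨hp.2, hp.1.1, hp.1.2⟩) hq'
  refine measure_mono_null hsub (measure_iUnion_null fun q => ?_)
  have := measure_setOf_measure_Ioc_eq_zero (contPart η) q
  rw [contPart, Measure.restrict_apply' (measurableSet_null_singleton η)] at this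
  exact this

/-- If `r < r'` had equal coordinates, the points of that common mass in the interval from `r`
(excluded) to `r'` (included) would be null. At an atom this contradicts the mass of `r'`; otherwise
a rational between them shows that `r'` is flat. -/
theorem eq_of_massRank_eq {η : Measure ℝ} [IsFiniteMeasure η] {r r' : ℝ} (hr : ¬ IsFlat η r)
    (hr' : ¬ IsFlat η r') (h : massRank η r = massRank η r') : r = r' := by
  have key : ∀ r r' : ℝ, ¬ IsFlat η r' → massRank η r = massRank η r' → ¬ r < r' := by
    intro r r' hr' h hlt
    simp only [massRank, Prod.mk.injEq] at h
    obtain ⟨h1, h2⟩ := h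
    rw [h1] at h2
    have hm : ∀ c r, MeasurableSet {q | η {q} = c ∧ q ≤ r} := fun c r =>
      (measurable_measure_singleton η (measurableSet_singleton c)).inter measurableSet_Iic
    have hdiff : η ({q | η {q} = η {r'} ∧ q ≤ r'} \ {q | η {q} = η {r'} ∧ q ≤ r}) = 0 := by
      rw [measure_sdiff _ (hm _ _).nullMeasurableSet (measure_ne_top _ _), h2, tsub_self]
      exact fun q hq => ⟨hq.1, hq.2.trans hlt.le⟩
    by_cases h0 : η {r'} = 0
    · obtain ⟨q, hq, hq'⟩ := exists_rat_btwn hlt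
      refine hr' ⟨h0, q, hq', measure_mono_null ?_ hdiff⟩
      rintro p ⟨hp0, hp1, hp2⟩
      exact ⟨⟨by rw [hp0, h0], hp2⟩, fun hp => absurd hp.2 (not_le.2 (hq.trans hp1))⟩
    · refine h0 (measure_mono_null ?_ hdiff)
      rintro _ rfl
      exact ⟨⟨rfl, le_rfl⟩, fun hp => absurd hp.2 (not_le.2 hlt)⟩
  exact le_antisymm (not_lt.1 (key r' r hr h.symm)) (not_lt.1 (key r r' hr' h))

end MassRank

/-! ### The law of the mass–rank coordinate -/

section MassRankLaw

theorem finite_setOf_le_measure_singleton (η : Measure ℝ) [IsFiniteMeasure η] (c : ℝ≥0∞)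
    (hc : 0 < c) : {r | c ≤ η {r}}.Finite :=
  Measure.finite_const_le_meas_of_disjoint_iUnion η hc (fun r => measurableSet_singleton r)
    (fun r r' h => by simpa using h) (measure_ne_top _ _)

theorem countable_atoms (η : Measure ℝ) [IsFiniteMeasure η] : {r | 0 < η {r}}.Countable :=
  Measure.countable_meas_pos_of_disjoint_iUnion (fun r => measurableSet_singleton r)
    (fun r r' h => by simpa using h)

/-- Two measures with the same ordered sequence of masses have the same number of atoms of each
mass, so these can be matched in an order preserving way. -/
theorem nonempty_orderIso_of_orderedSeq_eq {η η' : Measure ℝ} [IsFiniteMeasure η]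
    [IsFiniteMeasure η'] (h : orderedSeq (fun r => η {r}) = orderedSeq fun r => η' {r})
    {c : ℝ≥0∞} (hc : 0 < c) : Nonempty ({r | η {r} = c} ≃o {r | η' {r} = c}) := by
  have hcard := encard_setOf_eq_of_orderedSeq_eq (finite_setOf_le_measure_singleton η)
    (finite_setOf_le_measure_singleton η') (fun r => measure_ne_top _ _)
    (fun r => measure_ne_top _ _) h hc
  have hf : {r | η {r} = c}.Finite := (finite_setOf_le_measure_singleton η c hc).subset
    fun r (hr : η {r} = c) => hr.ge
  have hf' : {r | η' {r} = c}.Finite := (finite_setOf_le_measure_singleton η' c hc).subset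
    fun r (hr : η' {r} = c) => hr.ge
  have := hf.fintype
  have := hf'.fintype
  have hc' : Fintype.card {r | η {r} = c} = Fintype.card {r | η' {r} = c} := by
    rw [← Set.coe_fintypeCard, ← Set.coe_fintypeCard] at hcard
    exact_mod_cast hcard
  exact ⟨(monoEquivOfFin _ hc').symm.trans (monoEquivOfFin _ rfl)⟩

theorem measure_eq_card_mul {η : Measure ℝ} {S : Set ℝ} (hS : S.Finite) {c : ℝ≥0∞}
    (h : ∀ r ∈ S, η {r} = c) : η S = S.ncard * c := by
  have := sum_measure_singleton (μ := η) (s := hS.toFinset)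
  rw [hS.coe_toFinset] at this
  rw [← this, Finset.sum_congr rfl (g := fun _ => c) (fun r hr => h r (hS.mem_toFinset.1 hr)),
    Finset.sum_const, nsmul_eq_mul, Set.ncard_eq_toFinset_card S hS]

/-- The second coordinate of an atom of mass `c` is `c` times the number of atoms of that mass up to
it, which an order isomorphism preserves. -/
theorem massRank_orderIso {η η' : Measure ℝ} [IsFiniteMeasure η] [IsFiniteMeasure η']
    {c : ℝ≥0∞} (hc : 0 < c) (e : {r | η {r} = c} ≃o {r | η' {r} = c}) (a : {r | η {r} = c}) :
    massRank η' (e a) = massRank η a := by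
  have ha : η {(a : ℝ)} = c := a.2
  have hea : η' {(e a : ℝ)} = c := (e a).2
  have hf : {r | η {r} = c}.Finite := (finite_setOf_le_measure_singleton η c hc).subset
    fun r (hr : η {r} = c) => hr.ge
  have hf' : {r | η' {r} = c}.Finite := (finite_setOf_le_measure_singleton η' c hc).subset
    fun r (hr : η' {r} = c) => hr.ge
  simp only [massRank, ha, hea, Prod.mk.injEq, true_and]
  rw [measure_eq_card_mul (c := c) (hf'.subset fun q hq => hq.1) fun q hq => hq.1,
    measure_eq_card_mul (c := c) (hf.subset fun q hq => hq.1) fun q hq => hq.1]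
  congr 2
  have h1 : {q | η {q} = c ∧ q ≤ a} = Subtype.val '' {b : {r | η {r} = c} | b ≤ a} := by
    ext q
    constructor
    · rintro ⟨h1, h2⟩
      exact ⟨⟨q, h1⟩, h2, rfl⟩
    · rintro ⟨b, hb, rfl⟩
      exact ⟨b.2, hb⟩
  have h2 : {q | η' {q} = c ∧ q ≤ e a} =
      (fun b : {r | η {r} = c} => (e b : ℝ)) '' {b : {r | η {r} = c} | b ≤ a} := by
    ext q
    constructor
    · rintro ⟨h1, h2⟩
      refine ⟨e.symm ⟨q, h1⟩, ?_, by simp⟩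
      have : (⟨q, h1⟩ : {r | η' {r} = c}) ≤ e a := h2
      exact e.symm_apply_le.2 this
    · rintro ⟨b, hb, rfl⟩
      exact ⟨(e b).2, e.monotone hb⟩
  rw [h1, h2, Set.ncard_image_of_injective _ Subtype.val_injective,
    Set.ncard_image_of_injective (f := fun b : {r | η {r} = c} => (e b : ℝ)) _
      (Subtype.val_injective.comp e.injective)]

/-- The matching of the atoms of two measures with the same ordered sequence of masses. -/
theorem exists_atom_equiv {η η' : Measure ℝ} [IsFiniteMeasure η]
    [IsFiniteMeasure η'] (h : orderedSeq (fun r => η {r}) = orderedSeq fun r => η' {r}) :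
    ∃ e : {r | 0 < η {r}} ≃ {r | 0 < η' {r}}, ∀ a, massRank η' (e a) = massRank η a := by
  have hiso : ∀ c : {c : ℝ≥0∞ // 0 < c}, Nonempty ({r | η {r} = c} ≃o {r | η' {r} = c}) :=
    fun c => nonempty_orderIso_of_orderedSeq_eq h c.2
  let o := fun c => (hiso c).some
  let F : ∀ ρ : Measure ℝ, {r | 0 < ρ {r}} ≃ Σ c : {c : ℝ≥0∞ // 0 < c}, {r | ρ {r} = c} := fun ρ =>
    { toFun := fun r => ⟨⟨ρ {(r : ℝ)}, r.2⟩, ⟨r, rfl⟩⟩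
      invFun := fun p => ⟨p.2, by
        have : ρ {(p.2 : ℝ)} = p.1 := p.2.2
        change 0 < ρ {(p.2 : ℝ)}
        rw [this]
        exact p.1.2⟩
      left_inv := fun r => rfl
      right_inv := by
        rintro ⟨⟨c, hc⟩, ⟨r, hr⟩⟩
        change ρ {r} = c at hr
        subst hr
        rfl }
  refine ⟨(F η).trans ((Equiv.sigmaCongrRight fun c => (o c).toEquiv).trans (F η').symm),
    fun a => ?_⟩
  exact massRank_orderIso a.2 (o ⟨η {(a : ℝ)}, a.2⟩) ⟨a, rfl⟩

theorem measure_inter_atoms (η : Measure ℝ) [IsFiniteMeasure η] {S : Set ℝ} (hS : MeasurableSet S) :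
    η (S ∩ {r | 0 < η {r}}) = ∑' a : {r | 0 < η {r}}, S.indicator (fun r => η {r}) a := by
  have hc := countable_atoms η
  have := hc.to_subtype
  have h1 : S ∩ {r | 0 < η {r}} = ⋃ a : {r | 0 < η {r}}, S ∩ {(a : ℝ)} := by
    ext r
    simp only [Set.mem_inter_iff, Set.mem_iUnion, Set.mem_singleton_iff]
    constructor
    · rintro ⟨h1, h2⟩
      exact ⟨⟨r, h2⟩, h1, rfl⟩
    · rintro ⟨a, h1, rfl⟩
      exact ⟨h1, a.2⟩
  rw [h1, measure_iUnion]
  · refine tsum_congr fun a => ?_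
    by_cases ha : (a : ℝ) ∈ S
    · rw [Set.indicator_of_mem ha, Set.inter_eq_right.2 (Set.singleton_subset_iff.2 ha)]
    · rw [Set.indicator_of_notMem ha, Set.inter_singleton_eq_empty.2 ha, measure_empty]
  · intro a b hab
    refine Set.disjoint_left.2 fun x hx hx' => hab (Subtype.ext ?_)
    exact hx.2.symm.trans hx'.2
  · exact fun a => hS.inter (measurableSet_singleton _)

/-- Off the atoms the coordinate is `0` together with the distribution function of the atomless
part, so `map_measure_Iic_eq` applies to this share of the law. -/
theorem massRank_law_contPart (η : Measure ℝ) [IsFiniteMeasure η] {B : Set (ℝ≥0∞ × ℝ≥0∞)}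
    (hB : MeasurableSet B) : η (massRank η ⁻¹' B ∩ {r | η {r} = 0}) =
      (contPart η).map (fun q => contPart η (Set.Iic q)) {u | ((0 : ℝ≥0∞), u) ∈ B} := by
  have hB0 : MeasurableSet {u | ((0 : ℝ≥0∞), u) ∈ B} := measurable_prodMk_left hB
  rw [Measure.map_apply (measurable_measure_Iic _) hB0]
  conv_rhs => rw [contPart, Measure.restrict_apply' (measurableSet_null_singleton η)]
  congr 1
  ext r
  refine and_congr_left fun hr => ?_
  have hr : η {r} = 0 := hr
  have : massRank η r = (0, contPart η (Set.Iic r)) := by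
    rw [massRank, hr, contPart, Measure.restrict_apply measurableSet_Iic]
    congr 2
    ext q
    exact and_comm
  rw [Set.mem_preimage, this]
  rfl

/-- The law of the pair (mass, rank) only depends on the ordered sequence of masses of the atoms. -/
theorem map_massRank_eq {η η' : Measure ℝ} [IsProbabilityMeasure η]
    [IsProbabilityMeasure η'] (h : orderedSeq (fun r => η {r}) = orderedSeq fun r => η' {r}) :
    η.map (massRank η) = η'.map (massRank η') := by
  obtain ⟨e, he⟩ := exists_atom_equiv h
  have hcompl : ∀ ρ : Measure ℝ, {r | ρ {r} = 0} = {r | 0 < ρ {r}}ᶜ := fun ρ => by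
    ext r
    simp
  have hatoms : ∀ B, MeasurableSet B → η (massRank η ⁻¹' B ∩ {r | 0 < η {r}}) =
      η' (massRank η' ⁻¹' B ∩ {r | 0 < η' {r}}) := by
    intro B hB
    rw [measure_inter_atoms η (measurable_massRank η hB),
      measure_inter_atoms η' (measurable_massRank η' hB), ← e.tsum_eq]
    refine tsum_congr fun a => ?_
    have h1 : η' {(e a : ℝ)} = η {(a : ℝ)} := congrArg Prod.fst (he a)
    have h2 : (e a : ℝ) ∈ massRank η' ⁻¹' B ↔ (a : ℝ) ∈ massRank η ⁻¹' B := by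
      rw [Set.mem_preimage, Set.mem_preimage, he]
    by_cases ha : (a : ℝ) ∈ massRank η ⁻¹' B
    · rw [Set.indicator_of_mem ha, Set.indicator_of_mem (h2.2 ha), h1]
    · rw [Set.indicator_of_notMem ha, Set.indicator_of_notMem (mt h2.1 ha)]
  -- Both measures have total mass one and equal atomic mass, so the atomless parts have equal mass.
  have hcont : contPart η Set.univ = contPart η' Set.univ := by
    have h1 := hatoms Set.univ MeasurableSet.univ
    simp only [Set.preimage_univ, Set.univ_inter] at h1
    have hm : ∀ ρ : Measure ℝ, SFinite ρ → MeasurableSet {r | 0 < ρ {r}} := fun ρ _ => by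
      have := (measurableSet_null_singleton ρ).compl
      rwa [hcompl, compl_compl] at this
    rw [contPart, contPart, Measure.restrict_apply_univ, Measure.restrict_apply_univ, hcompl,
      hcompl, prob_compl_eq_one_sub (hm η inferInstance), prob_compl_eq_one_sub (hm η' inferInstance),
      h1]
  ext B hB
  rw [Measure.map_apply (measurable_massRank η) hB, Measure.map_apply (measurable_massRank η') hB,
    ← measure_inter_add_sdiff _ (measurableSet_null_singleton η),
    ← measure_inter_add_sdiff (massRank η' ⁻¹' B) (measurableSet_null_singleton η'),
    massRank_law_contPart η hB, massRank_law_contPart η' hB, map_measure_Iic_eq _ _ hcont,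
    Set.sdiff_eq, Set.sdiff_eq, hcompl, hcompl, compl_compl, compl_compl, hatoms B hB]

end MassRankLaw

/-! ### Disintegration along a measurable partition -/

namespace MeasurablePartition

section

variable {X : Type*} [MeasurableSpace X] (ξ : MeasurablePartition X)

/-- A real function that generates the partition. -/
noncomputable def fn : X → ℝ := ξ.exists_measurable.choose

theorem measurable_fn : Measurable ξ.fn := ξ.exists_measurable.choose_spec.1

theorem rel_iff {x y : X} : ξ.rel x y ↔ ξ.fn x = ξ.fn y := ξ.exists_measurable.choose_spec.2 x y

theorem measurable_proj : Measurable ξ.proj := fun _ h => h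

theorem measurable_proj_prodMk : Measurable fun x => (ξ.proj x, x) :=
  ξ.measurable_proj.prodMk measurable_id

theorem proj_eq_iff {x y : X} : ξ.proj x = ξ.proj y ↔ ξ.fn x = ξ.fn y :=
  Quotient.eq (r := ξ.rel).trans ξ.rel_iff

theorem proj_surjective : Function.Surjective ξ.proj := Quotient.mk_surjective

/-- The function on the quotient space that is induced by the generating function. -/
noncomputable def quotFn : ξ.Quot → ℝ := Quotient.lift ξ.fn fun _ _ h => ξ.rel_iff.1 h

theorem quotFn_proj (x : X) : ξ.quotFn (ξ.proj x) = ξ.fn x := rfl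

theorem measurable_quotFn : Measurable ξ.quotFn := measurable_from_quotient.2 ξ.measurable_fn

theorem quotFn_injective : Function.Injective ξ.quotFn := by
  intro C D h
  obtain ⟨x, rfl⟩ := ξ.proj_surjective C
  obtain ⟨y, rfl⟩ := ξ.proj_surjective D
  exact ξ.proj_eq_iff.2 h

instance : MeasurableSingletonClass ξ.Quot := by
  refine ⟨fun C => ?_⟩
  have : {C} = ξ.quotFn ⁻¹' {ξ.quotFn C} := by
    ext D
    simp [ξ.quotFn_injective.eq_iff]
  rw [this]
  exact ξ.measurable_quotFn (measurableSet_singleton _)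

theorem sigmaAlgebra_le : ξ.sigmaAlgebra ≤ ‹MeasurableSpace X› := ξ.measurable_proj.comap_le

instance (μ : Measure X) [IsProbabilityMeasure μ] : IsProbabilityMeasure (ξ.quotMeasure μ) :=
  Measure.isProbabilityMeasure_map ξ.measurable_proj.aemeasurable

theorem ae_quotMeasure_iff (μ : Measure X) {p : ξ.Quot → Prop} :
    (∀ᵐ C ∂(ξ.quotMeasure μ), p C) → ∀ᵐ x ∂μ, p (ξ.proj x) :=
  ae_of_ae_map ξ.measurable_proj.aemeasurable

/-- Measurable unions of blocks are preimages of Borel sets under the generating function. -/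
theorem exists_preimage_fn_eq [StandardBorelSpace X] {B : Set ξ.Quot} (hB : MeasurableSet B) :
    ∃ B' : Set ℝ, MeasurableSet B' ∧ ∀ x, ξ.proj x ∈ B ↔ ξ.fn x ∈ B' := by
  classical
  obtain ⟨u, hu, hu'⟩ := exists_measurable_factor (MeasurableSet.univ (α := X)) ξ.measurable_fn
    (g := fun x => decide (ξ.proj x ∈ B))
    ((Measurable.of_discrete (f := fun p : Prop => decide p)).comp
      (measurable_mem.2 (ξ.measurable_proj hB)))
    fun x _ y _ h => by rw [ξ.proj_eq_iff.2 h]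
  refine ⟨u ⁻¹' {true}, hu (measurableSet_singleton _), fun x => ?_⟩
  rw [Set.mem_preimage, ← hu' x trivial]
  simp

end

section Conditional

variable {X : Type*} [MeasurableSpace X] [StandardBorelSpace X] (ξ : MeasurablePartition X)
  (μ : Measure X) [IsProbabilityMeasure μ]

theorem condMeasure_proj (x : X) :
    ξ.condMeasure μ (ξ.proj x) = condExpKernel μ ξ.sigmaAlgebra x := rfl

/-- The conditional measures as a kernel. -/
noncomputable def condKernel : Kernel ξ.Quot X where
  toFun := ξ.condMeasure μ
  measurable' := measurable_from_quotient.2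
    ((condExpKernel μ ξ.sigmaAlgebra).measurable.mono ξ.sigmaAlgebra_le le_rfl)

theorem condKernel_apply (C : ξ.Quot) : ξ.condKernel μ C = ξ.condMeasure μ C := rfl

instance : IsMarkovKernel (ξ.condKernel μ) := by
  refine ⟨fun C => ?_⟩
  obtain ⟨x, rfl⟩ := ξ.proj_surjective C
  rw [condKernel_apply, condMeasure_proj]
  infer_instance

instance (C : ξ.Quot) : IsProbabilityMeasure (ξ.condMeasure μ C) :=
  inferInstanceAs (IsProbabilityMeasure (ξ.condKernel μ C))

/-- The conditional measures come from `condExpKernel` on a sub-σ-algebra of `X`; this is the same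
disintegration stated over the quotient space, the form in which null sets and blocks can be
handled. -/
theorem quotMeasure_compProd_condKernel :
    ξ.quotMeasure μ ⊗ₘ ξ.condKernel μ = μ.map fun x => (ξ.proj x, x) := by
  refine Measure.ext_prod fun {B E} hB hE => ?_
  rw [Measure.compProd_apply_prod hB hE, Measure.map_apply ξ.measurable_proj_prodMk
    (hB.prod hE), quotMeasure, setLIntegral_map hB (Kernel.measurable_coe _ hE) ξ.measurable_proj]
  have hB' : MeasurableSet[ξ.sigmaAlgebra] (ξ.proj ⁻¹' B) := ⟨B, hB, rfl⟩
  have h := compProd_trim_condExpKernel (μ := μ) ξ.sigmaAlgebra_le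
  have h2 := congrArg (fun ρ => ρ ((ξ.proj ⁻¹' B) ×ˢ E)) h
  rw [Measure.compProd_apply_prod hB' hE, restrict_trim _ _ hB',
    lintegral_trim _ (measurable_condExpKernel hE),
    Measure.map_apply _ (hB'.prod hE)] at h2
  · exact h2
  · exact (measurable_id'' ξ.sigmaAlgebra_le).prodMk measurable_id

theorem ae_condMeasure_of_ae {p : X → Prop} (h : ∀ᵐ x ∂μ, p x) :
    ∀ᵐ C ∂(ξ.quotMeasure μ), ∀ᵐ x ∂(ξ.condMeasure μ C), p x := by
  have hsnd : (μ.map fun x => (ξ.proj x, x)).map Prod.snd = μ := by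
    rw [Measure.map_map measurable_snd ξ.measurable_proj_prodMk]
    exact Measure.map_id
  rw [← hsnd] at h
  have h' := ae_of_ae_map measurable_snd.aemeasurable h
  rw [← quotMeasure_compProd_condKernel] at h'
  exact Measure.ae_ae_of_ae_compProd h'

theorem ae_condMeasure_proj_eq :
    ∀ᵐ C ∂(ξ.quotMeasure μ), ∀ᵐ x ∂(ξ.condMeasure μ C), ξ.proj x = C := by
  refine Measure.ae_ae_of_ae_compProd (κ := ξ.condKernel μ) (p := fun q => ξ.proj q.2 = q.1) ?_
  rw [quotMeasure_compProd_condKernel, ae_map_iff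
    ξ.measurable_proj_prodMk.aemeasurable]
  · exact Filter.Eventually.of_forall fun x => rfl
  · have : {q : ξ.Quot × X | ξ.proj q.2 = q.1} = {q | ξ.fn q.2 = ξ.quotFn q.1} := by
      ext q
      exact (ξ.quotFn_injective.eq_iff (a := ξ.proj q.2)).symm
    rw [this]
    exact measurableSet_eq_fun (ξ.measurable_fn.comp measurable_snd)
      (ξ.measurable_quotFn.comp measurable_fst)

/-- The projection and the generating function define the same events. Conditioning may therefore be
done over the line, where isomorphisms of filtrations induce Borel factor maps. -/
theorem condMeasure_ae_eq_condDistrib [Nonempty X] : ∀ᵐ C ∂(ξ.quotMeasure μ),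
    ξ.condMeasure μ C = condDistrib id ξ.fn μ (ξ.quotFn C) := by
  have h1 : condDistrib id ξ.proj μ =ᵐ[μ.map ξ.proj] ξ.condKernel μ :=
    condDistrib_ae_eq_of_measure_eq_compProd ξ.proj aemeasurable_id
      (ξ.quotMeasure_compProd_condKernel μ).symm
  have h2 := condDistrib_map_eq_of_compatible ξ.measurable_proj ξ.measurable_fn
    (MeasurePreserving.id μ) ξ.measurable_quotFn (Filter.Eventually.of_forall fun x => rfl)
    fun B hB => by
      obtain ⟨B', hB', h⟩ := ξ.exists_preimage_fn_eq hB
      exact ⟨B', hB', Filter.Eventually.of_forall h⟩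
  filter_upwards [h1, h2] with C hC1 hC2
  rw [← hC2, Measure.map_id, hC1, condKernel_apply]

/-- Blocks with finitely supported conditional measures are null sets of an atomless measure. -/
theorem measure_block_eq_zero [NullSingletonClass μ] (hξ : ξ.IsDiscrete μ) (C : ξ.Quot) :
    μ (ξ.proj ⁻¹' {C}) = 0 := by
  by_contra h0
  have hC : MeasurableSet ({C} : Set ξ.Quot) := measurableSet_singleton C
  have hν : ξ.quotMeasure μ {C} ≠ 0 := by
    rwa [quotMeasure, Measure.map_apply ξ.measurable_proj hC]
  obtain ⟨s, hs⟩ : ∃ s : Finset X, ξ.condMeasure μ C (↑s)ᶜ = 0 := by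
    by_contra hne
    exact hν (measure_mono_null (Set.singleton_subset_iff.2 hne) hξ)
  have hpt : ∀ y, ξ.condMeasure μ C {y} = 0 := fun y => by
    have h := congrArg (fun ρ => ρ ({C} ×ˢ {y})) (ξ.quotMeasure_compProd_condKernel μ)
    rw [Measure.compProd_apply_prod hC (measurableSet_singleton y), Measure.restrict_singleton,
      lintegral_smul_measure, lintegral_dirac, Measure.map_apply
        ξ.measurable_proj_prodMk (hC.prod (measurableSet_singleton y))] at h
    have h0' : μ ((fun x => (ξ.proj x, x)) ⁻¹' ({C} ×ˢ {y})) = 0 :=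
      measure_mono_null (fun x hx => hx.2) (measure_singleton y)
    rw [h0', smul_eq_mul, mul_eq_zero] at h
    exact h.resolve_left hν
  have hs0 : ξ.condMeasure μ C (s : Set X) = 0 := by
    rw [← Set.biUnion_of_singleton (s : Set X)]
    exact (measure_biUnion_null_iff s.countable_toSet).2 fun y _ => hpt y
  have : ξ.condMeasure μ C Set.univ = 0 := by
    rw [← Set.union_compl_self (s : Set X)]
    exact measure_union_null hs0 hs
  simp at this

end Conditional

end MeasurablePartition

/-! ### The tree of a block and the measurable numbering of its leaves -/

namespace FiniteFiltration

variable {X : Type*} [MeasurableSpace X] {μ : Measure X} {n : ℕ} (τ : FiniteFiltration μ n)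

/-- Outside a null set, the partitions of a filtration decrease from the partition into singletons
at every place. -/
theorem ae_decreasing : ∃ A ∈ ae μ, (∀ x ∈ A, ∀ y ∈ A, (τ.part 0).rel x y → x = y) ∧
    ∀ k l, k ≤ l → ∀ x ∈ A, ∀ y ∈ A, (τ.part k).rel x y → (τ.part l).rel x y := by
  obtain ⟨A, hA, h⟩ := τ.singletons
  have hd : ∀ p : Fin (n + 1) × Fin (n + 1), ∃ A ∈ ae μ, p.1 ≤ p.2 → ∀ x ∈ A, ∀ y ∈ A,
      (τ.part p.1).rel x y → (τ.part p.2).rel x y := fun p => by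
    by_cases hp : p.1 ≤ p.2
    · obtain ⟨B, hB, hB'⟩ := τ.decreasing _ _ hp
      exact ⟨B, hB, fun _ => hB'⟩
    · exact ⟨Set.univ, Filter.univ_mem, fun h => absurd h hp⟩
  choose B hB hB' using hd
  refine ⟨A ∩ ⋂ p, B p, Filter.inter_mem hA (Filter.iInter_mem.2 hB),
    fun x hx y hy => h x hx.1 y hy.1, fun k l hkl x hx y hy => ?_⟩
  exact hB' (k, l) hkl x (Set.mem_iInter.1 hx.2 _) y (Set.mem_iInter.1 hy.2 _)

/-- The functions that generate the partitions of a filtration. -/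
noncomputable def fns (k : Fin (n + 1)) : X → ℝ := (τ.part k).fn

theorem measurable_fns (k : Fin (n + 1)) : Measurable (τ.fns k) := (τ.part k).measurable_fn

variable [StandardBorelSpace X] [IsProbabilityMeasure μ]

theorem represents_iff {C : τ.last.Quot} {M : LabelledTree n} :
    τ.Represents C M ↔ ∃ e, IsLabelling τ.fns (τ.last.condMeasure μ C) M e := by
  refine exists_congr fun e => ⟨fun ⟨h1, h2, h3, h4⟩ => ⟨h1, h2, h3, fun k i j => ?_⟩,
    fun ⟨h1, h2, h3, h4⟩ => ⟨h1, h2, h3, fun k i j => ?_⟩⟩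
  · rw [h4, MeasurablePartition.rel_iff]
    rfl
  · rw [h4, MeasurablePartition.rel_iff]
    rfl

/-- All labelled trees representing a block are isomorphic, so the arbitrary choice in `treeMap` has
no effect. -/
theorem treeMap_eq_of_isLabelling {C : τ.last.Quot} {M : LabelledTree n} {e : Fin M.1.card → X}
    (h : IsLabelling τ.fns (τ.last.condMeasure μ C) M e) : τ.treeMap C = Quotient.mk _ M := by
  have hex : ∃ T : Tree n, ∃ M : LabelledTree n, τ.Represents C M ∧ Quotient.mk _ M = T :=
    ⟨_, M, τ.represents_iff.2 ⟨e, h⟩, rfl⟩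
  obtain ⟨N, hN, hNT⟩ := Classical.epsilon_spec hex
  obtain ⟨e', he'⟩ := τ.represents_iff.1 hN
  rw [treeMap, ← hNT]
  exact Quotient.sound (he'.iso h)

theorem ae_exists_isLabelling (hτ : τ.last.IsDiscrete μ) :
    ∀ᵐ C ∂(τ.last.quotMeasure μ), ∃ M e, IsLabelling τ.fns (τ.last.condMeasure μ C) M e := by
  obtain ⟨A, hA, hsing, hdec⟩ := τ.ae_decreasing
  have hA' : ∀ᵐ x ∂μ, x ∈ A := hA
  filter_upwards [hτ, τ.last.ae_condMeasure_of_ae μ hA', τ.last.ae_condMeasure_proj_eq μ]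
    with C ⟨s, hs⟩ hCA hCC
  set ρ := τ.last.condMeasure μ C
  set D := {y | 0 < ρ {y}} with hD
  have hae : ∀ {p : X → Prop}, (∀ᵐ x ∂ρ, p x) → ∀ x ∈ D, p x := fun {p} hp x hx => by
    by_contra hne
    exact (hx : 0 < ρ {x}).ne' (measure_mono_null (Set.singleton_subset_iff.2 hne) hp)
  have hDs : D ⊆ s := hae (p := fun x => x ∈ (s : Set X)) hs
  have hDfin : D.Finite := s.finite_toSet.subset hDs
  have hDA : ∀ x ∈ D, x ∈ A := hae hCA
  have hDC : ∀ x ∈ D, τ.last.proj x = C := hae hCC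
  have hDnull : ρ Dᶜ = 0 := by
    -- The given finite carrier may contain points of zero mass; only the atoms become leaves.
    have h1 : ρ ((s : Set X) \ D) = 0 := by
      rw [← Set.biUnion_of_singleton ((s : Set X) \ D)]
      refine (measure_biUnion_null_iff (s.countable_toSet.mono Set.sdiff_subset)).2 fun y hy => ?_
      exact le_antisymm (not_lt.1 hy.2) zero_le
    refine measure_mono_null (fun x hx => ?_) (measure_union_null hs h1)
    by_cases hxs : x ∈ (s : Set X)
    · exact Or.inr ⟨hxs, hx⟩
    · exact Or.inl hxs
  have hDone : ρ D = 1 := (prob_compl_eq_zero_iff hDfin.measurableSet).1 hDnull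
  have := hDfin.fintype
  let e := (Fintype.equivFin D).symm
  let S : TreeShape n :=
    { card := Fintype.card D
      part := fun k => (τ.part k).rel.comap fun i => (e i : X)
      mono := fun k l hkl i j h => hdec k l hkl _ (hDA _ (e i).2) _ (hDA _ (e j).2) h
      part_zero := by
        ext i j
        refine ⟨fun h => ?_, fun h => ?_⟩
        · exact e.injective (Subtype.ext (hsing _ (hDA _ (e i).2) _ (hDA _ (e j).2) h))
        · obtain rfl : i = j := h
          exact (τ.part 0).rel.refl _
      part_last := by
        ext i j
        refine ⟨fun _ => trivial, fun _ => ?_⟩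
        have h1 := (hDC _ (e i).2).trans (hDC _ (e j).2).symm
        exact Quotient.exact (s := τ.last.rel) h1 }
  have hsum : ∑ i, ρ {(e i : X)} = 1 := by
    rw [← hDone, Equiv.sum_comp e (fun x : D => ρ {(x : X)}), ← tsum_fintype (L := .unconditional _),
      ← measure_iUnion]
    · congr 1
      ext x
      simp
    · intro a b hab
      simpa using fun h => hab (Subtype.ext h)
    · exact fun a => measurableSet_singleton _
  refine ⟨⟨S, ⟨fun i => ρ {(e i : X)}, fun i => (e i).2, hsum⟩⟩, fun i => (e i : X),
    Subtype.val_injective.comp e.injective, ?_, fun i => rfl, fun k i j => ?_⟩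
  · change Set.range (Subtype.val ∘ e) = D
    rw [e.surjective.range_comp, Subtype.range_coe]
  · exact (τ.part k).rel_iff

/-- A measurable labelling of the blocks of a filtration by the canonical forms of their trees. -/
theorem exists_measurable_label (hτ : τ.last.IsDiscrete μ) :
    ∃ (T : τ.last.Quot → Tree n) (lab : X → ℕ), Measurable T ∧ Measurable lab ∧
      τ.treeMap =ᵐ[τ.last.quotMeasure μ] T ∧ ∀ᵐ C ∂(τ.last.quotMeasure μ),
        ∃ e, IsLabelling τ.fns (τ.last.condMeasure μ C) (treeSection n (T C)) e ∧
          ∀ i, lab (e i) = i := by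
  obtain ⟨T, lab, hT, hlab, h⟩ := exists_measurable_labelling τ.measurable_fns (τ.last.condKernel μ)
  have hex := τ.ae_exists_isLabelling hτ
  refine ⟨T, fun x => lab (τ.last.proj x, x), hT, hlab.comp τ.last.measurable_proj_prodMk, ?_, ?_⟩
  · filter_upwards [hex] with C hC
    obtain ⟨e, he, -⟩ := h C hC
    rw [τ.treeMap_eq_of_isLabelling he, mk_treeSection]
  · filter_upwards [hex, τ.last.ae_condMeasure_proj_eq μ] with C hC hCC
    obtain ⟨e, he, hl⟩ := h C hC
    have he : IsLabelling τ.fns (τ.last.condMeasure μ C) (treeSection n (T C)) e := he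
    exact ⟨e, he, fun i => by rw [he.forall_of_ae hCC i, hl]⟩

theorem aemeasurable_treeMap (hτ : τ.last.IsDiscrete μ) :
    AEMeasurable τ.treeMap (τ.last.quotMeasure μ) := by
  obtain ⟨T, -, hT, -, h, -⟩ := τ.exists_measurable_label hτ
  exact ⟨T, hT, h⟩

theorem ae_represents (hτ : τ.last.IsDiscrete μ) : ∀ᵐ C ∂(τ.last.quotMeasure μ),
    ∃ M, τ.Represents C M ∧ τ.treeMap C = Quotient.mk _ M := by
  filter_upwards [τ.ae_exists_isLabelling hτ] with C ⟨M, e, h⟩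
  exact ⟨M, τ.represents_iff.2 ⟨e, h⟩, τ.treeMap_eq_of_isLabelling h⟩

end FiniteFiltration

/-- The mass of the leaf with number `j` in the canonical form of a tree. -/
noncomputable def leafMass {n : ℕ} (T : Tree n) (j : ℕ) : ℝ≥0∞ :=
  if h : j < (treeSection n T).1.card then (treeSection n T).mass ⟨j, h⟩ else 0

theorem measurable_leafMass {n : ℕ} (j : ℕ) : Measurable fun T : Tree n => leafMass T j := by
  have : Measurable fun M : LabelledTree n => if h : j < M.1.card then M.mass ⟨j, h⟩ else 0 := by
    refine measurable_sigma_iff.2 fun s => ?_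
    by_cases h : j < s.card
    · simp only [h, dif_pos]
      exact (measurable_pi_apply (⟨j, h⟩ : Fin s.card)).comp (measurable_subtype_coe
        (p := fun w : Fin s.card → ℝ≥0∞ => (∀ i, 0 < w i) ∧ ∑ i, w i = 1))
    · simp only [h, dif_neg, not_false_eq_true, measurable_const]
  exact this.comp (measurable_treeSection n)

/-- Two leaves of the canonical form of a tree, given by their numbers, lie under the same vertex of
level `k`. -/
def LeafRel {n : ℕ} (T : Tree n) (k : Fin (n + 1)) (a b : ℕ) : Prop :=
  ∃ (ha : a < (treeSection n T).1.card) (hb : b < (treeSection n T).1.card),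
    (treeSection n T).1.part k ⟨a, ha⟩ ⟨b, hb⟩

theorem leafRel_coe {n : ℕ} {T : Tree n} {k : Fin (n + 1)} {i j : Fin (treeSection n T).1.card} :
    LeafRel T k i j ↔ (treeSection n T).1.part k i j :=
  ⟨fun ⟨_, _, h⟩ => h, fun h => ⟨i.2, j.2, h⟩⟩

theorem IsLabelling.measure_preimage_eq_leafMass {X : Type*} [MeasurableSpace X]
    [MeasurableSingletonClass X] {n : ℕ}
    {f : Fin (n + 1) → X → ℝ} {ρ : Measure X} [IsProbabilityMeasure ρ] {T : Tree n}
    {e : Fin (treeSection n T).1.card → X} (h : IsLabelling f ρ (treeSection n T) e) {lab : X → ℕ}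
    (hl : ∀ i, lab (e i) = i) (j : ℕ) : ρ (lab ⁻¹' {j}) = leafMass T j := by
  have hae : ∀ᵐ x ∂ρ, x ∈ Set.range e := h.measure_compl_range
  rw [leafMass]
  split_ifs with hj
  · rw [h.mass_eq]
    refine measure_congr ?_
    filter_upwards [hae]
    rintro _ ⟨i, rfl⟩
    refine propext ⟨fun hi => ?_, fun hi => ?_⟩
    · have hi : lab (e i) = j := hi
      rw [hl] at hi
      exact congrArg e (Fin.ext hi)
    · have hi : e i = e ⟨j, hj⟩ := hi
      change lab (e i) = j
      rw [hi, hl]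
  · refine measure_mono_null ?_ h.measure_compl_range
    rintro _ hx ⟨i, rfl⟩
    have hx : lab (e i) = j := hx
    rw [hl] at hx
    exact hj (hx ▸ i.2)

theorem measure_inter_preimage_eq_tsum {X : Type*} [MeasurableSpace X] (μ : Measure X) {E : Set X}
    (hE : MeasurableSet E) {f : X → ℕ} (hf : Measurable f) (S : Set ℕ) :
    μ (E ∩ f ⁻¹' S) = ∑' j : S, μ (E ∩ f ⁻¹' {(j : ℕ)}) := by
  have hS : (⋃ j : S, ({(j : ℕ)} : Set ℕ)) = S := by ext; simp
  rw [← measure_iUnion, ← Set.inter_iUnion, ← Set.preimage_iUnion, hS]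
  · intro i j hij
    refine Set.disjoint_left.2 fun x hx hx' => hij (Subtype.ext ?_)
    exact (hx.2 : f x = i).symm.trans hx'.2
  · exact fun j => hE.inter (hf (measurableSet_singleton _))

/-! ### The canonical model; equal invariants give isomorphic filtrations -/

namespace FiniteFiltration

variable {X : Type*} [MeasurableSpace X] {μ : Measure X} {n : ℕ} (τ : FiniteFiltration μ n)
  [StandardBorelSpace X] [IsProbabilityMeasure μ]

/-- The conditional measures on the space itself, given the tree of a point. -/
noncomputable def fibreKernel : Kernel (Tree n) X :=
  haveI : Nonempty X := nonempty_of_isProbabilityMeasure μ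
  condDistrib id (fun x => τ.treeMap (τ.last.proj x)) μ

instance : IsMarkovKernel τ.fibreKernel := by
  unfold fibreKernel
  infer_instance

/-- The conditional measures of the generating function of the last partition, given the tree. -/
noncomputable def fibreFn : Kernel (Tree n) ℝ := τ.fibreKernel.map τ.last.fn

instance : IsMarkovKernel τ.fibreFn := Kernel.IsMarkovKernel.map _ τ.last.measurable_fn

theorem fibreFn_apply (T : Tree n) {S : Set ℝ} (hS : MeasurableSet S) :
    τ.fibreFn T S = τ.fibreKernel T (τ.last.fn ⁻¹' S) :=
  Kernel.map_apply' _ τ.last.measurable_fn _ hS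

theorem fibreMeasure_apply (T : Tree n) {B : Set τ.last.Quot} (hB : MeasurableSet B) :
    τ.fibreMeasure T B = τ.fibreKernel T (τ.last.proj ⁻¹' B) :=
  Measure.map_apply τ.last.measurable_proj hB

/-- The generating function is injective on blocks, so it carries the atoms of the fibre measure to
the atoms of its image on the line, with the same masses. -/
theorem multiplicity_eq (T : Tree n) :
    τ.multiplicity T = orderedSeq fun r => τ.fibreFn T {r} := by
  have key : ∀ C, τ.fibreFn T {τ.last.quotFn C} = τ.fibreMeasure T {C} := fun C => by
    rw [τ.fibreFn_apply T (measurableSet_singleton _), τ.fibreMeasure_apply T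
      (measurableSet_singleton C)]
    congr 1
    ext x
    exact τ.last.quotFn_injective.eq_iff (a := τ.last.proj x)
  refine orderedSeq_eq_of_bijOn τ.last.quotFn ⟨fun C hC => ?_, τ.last.quotFn_injective.injOn,
    fun r hr => ?_⟩ fun C _ => key C
  · change 0 < τ.fibreFn T {τ.last.quotFn C}
    rw [key]
    exact hC
  · have hr : 0 < τ.fibreFn T {r} := hr
    rw [τ.fibreFn_apply T (measurableSet_singleton _)] at hr
    obtain ⟨x, rfl⟩ := nonempty_of_measure_ne_zero hr.ne'
    refine ⟨τ.last.proj x, ?_, rfl⟩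
    change 0 < τ.fibreMeasure T {τ.last.proj x}
    rw [← key, τ.fibreFn_apply T (measurableSet_singleton _)]
    exact hr

section Model

variable {τ}

theorem aemeasurable_treeMap_proj (hτ : τ.last.IsDiscrete μ) :
    AEMeasurable (fun x => τ.treeMap (τ.last.proj x)) μ :=
  (τ.aemeasurable_treeMap hτ).comp_measurable τ.last.measurable_proj

theorem treeMeasure_eq_map (hτ : τ.last.IsDiscrete μ) :
    τ.treeMeasure = μ.map fun x => τ.treeMap (τ.last.proj x) :=
  AEMeasurable.map_map_of_aemeasurable (τ.aemeasurable_treeMap hτ)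
    τ.last.measurable_proj.aemeasurable

theorem isProbabilityMeasure_treeMeasure (hτ : τ.last.IsDiscrete μ) :
    IsProbabilityMeasure τ.treeMeasure := by
  rw [treeMeasure_eq_map hτ]
  exact Measure.isProbabilityMeasure_map (aemeasurable_treeMap_proj hτ)

theorem treeMeasure_compProd_fibreKernel (hτ : τ.last.IsDiscrete μ) :
    τ.treeMeasure ⊗ₘ τ.fibreKernel =
    μ.map fun x => (τ.treeMap (τ.last.proj x), x) := by
  have : Nonempty X := nonempty_of_isProbabilityMeasure μ
  rw [treeMeasure_eq_map hτ]
  exact compProd_map_condDistrib aemeasurable_id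

/-- A filtration is determined by an almost injective map to a space of trees with additional
parameters, whose law only depends on the measure on trees and on the multiplicities. -/
theorem exists_model (hτ : τ.last.IsDiscrete μ) :
    ∃ (P : τ.last.Quot → Tree n × (ℝ≥0∞ × ℝ≥0∞)) (lab : X → ℕ) (A : Set X),
    Measurable P ∧ Measurable lab ∧ MeasurableSet A ∧ μ Aᶜ = 0 ∧
    Set.InjOn (fun x => (P (τ.last.proj x), lab x)) A ∧
    (∀ k, ∀ x ∈ A, ∀ y ∈ A, (τ.part k).rel x y ↔
      P (τ.last.proj x) = P (τ.last.proj y) ∧ LeafRel (P (τ.last.proj x)).1 k (lab x) (lab y)) ∧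
    (∀ B, MeasurableSet B → (τ.last.quotMeasure μ).map P B =
      ∫⁻ T, (τ.fibreFn T).map (massRank (τ.fibreFn T)) (Prod.mk T ⁻¹' B) ∂τ.treeMeasure) ∧
    ∀ B, MeasurableSet B → ∀ j, μ ((τ.last.proj ⁻¹' (P ⁻¹' B)) ∩ lab ⁻¹' {j}) =
      ∫⁻ p in B, leafMass p.1 j ∂((τ.last.quotMeasure μ).map P) := by
  obtain ⟨t, lab, ht, hlab, htree, hgood⟩ := τ.exists_measurable_label hτ
  have := isProbabilityMeasure_treeMeasure hτ
  -- The measurable version `t` replaces `treeMap`; the position of the block in the fibre over its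
  -- tree is the mass–rank of its generating value.
  let P : τ.last.Quot → Tree n × (ℝ≥0∞ × ℝ≥0∞) := fun C =>
    (t C, massRank (τ.fibreFn (t C)) (τ.last.quotFn C))
  have hP : Measurable P := ht.prodMk ((measurable_kernel_massRank τ.fibreFn).comp
    (ht.prodMk τ.last.measurable_quotFn))
  have hlaw : τ.treeMeasure ⊗ₘ τ.fibreKernel = μ.map fun x => (t (τ.last.proj x), x) := by
    rw [treeMeasure_compProd_fibreKernel hτ]
    refine Measure.map_congr ?_
    filter_upwards [τ.last.ae_quotMeasure_iff μ htree] with x hx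
    rw [hx]
  have htx : Measurable fun x => (t (τ.last.proj x), x) :=
    (ht.comp τ.last.measurable_proj).prodMk measurable_id
  have hflat : ∀ᵐ x ∂μ, ¬ IsFlat (τ.fibreFn (t (τ.last.proj x))) (τ.last.fn x) := by
    have hm : MeasurableSet {p : Tree n × X | ¬ IsFlat (τ.fibreFn p.1) (τ.last.fn p.2)} :=
      ((measurable_fst.prodMk (τ.last.measurable_fn.comp measurable_snd))
        (measurableSet_isFlat τ.fibreFn)).compl
    have h : ∀ᵐ p ∂(τ.treeMeasure ⊗ₘ τ.fibreKernel), ¬ IsFlat (τ.fibreFn p.1) (τ.last.fn p.2) := by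
      refine Measure.ae_compProd_of_ae_ae hm (Filter.Eventually.of_forall fun T => ?_)
      have h0 := measure_isFlat (τ.fibreFn T)
      have hm' : MeasurableSet {r | IsFlat (τ.fibreFn T) r} :=
        measurable_prodMk_left (x := T) (measurableSet_isFlat τ.fibreFn)
      rw [τ.fibreFn_apply T hm'] at h0
      rw [ae_iff]
      simpa using! h0
    rw [hlaw, ae_map_iff htx.aemeasurable hm] at h
    exact h
  -- Almost every point is an atom of its own conditional measure and is therefore one of the
  -- labelled leaves.
  have hatom : ∀ᵐ x ∂μ, 0 < τ.last.condMeasure μ (τ.last.proj x) {x} := by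
    have hm : Measurable fun p : τ.last.Quot × X => τ.last.condMeasure μ p.1 {p.2} := by
      have hd : MeasurableSet {q : (τ.last.Quot × X) × X | q.2 = q.1.2} :=
        measurableSet_eq_fun measurable_snd (measurable_snd.comp measurable_fst)
      exact Kernel.measurable_kernel_prodMk_left (κ := (τ.last.condKernel μ).prodMkRight X) hd
    have hm' : MeasurableSet {p : τ.last.Quot × X | 0 < τ.last.condMeasure μ p.1 {p.2}} :=
      measurableSet_lt measurable_const hm
    have h : ∀ᵐ p ∂(τ.last.quotMeasure μ ⊗ₘ τ.last.condKernel μ),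
        0 < τ.last.condMeasure μ p.1 {p.2} := by
      refine Measure.ae_compProd_of_ae_ae hm' ?_
      filter_upwards [hgood] with C ⟨e, he, _⟩
      have hr : ∀ᵐ x ∂(τ.last.condMeasure μ C), x ∈ Set.range e := he.measure_compl_range
      rw [he.range_eq] at hr
      exact hr
    rw [MeasurablePartition.quotMeasure_compProd_condKernel,
      ae_map_iff τ.last.measurable_proj_prodMk.aemeasurable hm'] at h
    exact h
  obtain ⟨A₀, hA₀, -, hdec⟩ := τ.ae_decreasing
  have hA₀' : ∀ᵐ x ∂μ, x ∈ A₀ := hA₀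
  have hall := (hflat.and hatom).and (hA₀'.and (τ.last.ae_quotMeasure_iff μ hgood))
  obtain ⟨N, hN, hNm, hN0⟩ := exists_measurable_superset_of_null (ae_iff.1 hall)
  have hA : ∀ x ∈ Nᶜ, (¬ IsFlat (τ.fibreFn (t (τ.last.proj x))) (τ.last.fn x) ∧
      0 < τ.last.condMeasure μ (τ.last.proj x) {x}) ∧ x ∈ A₀ ∧
      ∃ e, IsLabelling τ.fns (τ.last.condMeasure μ (τ.last.proj x))
        (treeSection n (t (τ.last.proj x))) e ∧ ∀ i, lab (e i) = i := fun x hx => by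
    by_contra hne
    exact hx (hN hne)
  have hblock : ∀ x ∈ Nᶜ, ∀ y ∈ Nᶜ, P (τ.last.proj x) = P (τ.last.proj y) →
      τ.last.proj x = τ.last.proj y := fun x hx y hy h => by
    obtain ⟨⟨hfx, -⟩, -⟩ := hA x hx
    obtain ⟨⟨hfy, -⟩, -⟩ := hA y hy
    simp only [P, Prod.mk.injEq] at h
    obtain ⟨h1, h2⟩ := h
    rw [← h1] at hfy h2
    exact τ.last.proj_eq_iff.2 (eq_of_massRank_eq hfx hfy h2)
  have hlabels : ∀ x ∈ Nᶜ, ∀ y ∈ Nᶜ, τ.last.proj x = τ.last.proj y →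
      ∃ e : Fin (treeSection n (t (τ.last.proj x))).1.card → X,
        IsLabelling τ.fns (τ.last.condMeasure μ (τ.last.proj x))
          (treeSection n (t (τ.last.proj x))) e ∧
        ∃ i j, x = e i ∧ y = e j ∧ lab x = i ∧ lab y = j := fun x hx y hy h => by
    obtain ⟨⟨-, hx0⟩, -, e, he, hl⟩ := hA x hx
    obtain ⟨⟨-, hy0⟩, -⟩ := hA y hy
    rw [← h] at hy0
    have hx' : x ∈ Set.range e := by
      rw [he.range_eq]
      exact hx0
    have hy' : y ∈ Set.range e := by
      rw [he.range_eq]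
      exact hy0
    obtain ⟨i, hi⟩ := hx'
    obtain ⟨j, hj⟩ := hy'
    exact ⟨e, he, i, j, hi.symm, hj.symm, (congrArg lab hi.symm).trans (hl i),
      (congrArg lab hj.symm).trans (hl j)⟩
  refine ⟨P, lab, Nᶜ, hP, hlab, hNm.compl, by rwa [compl_compl], ?_, ?_, ?_, ?_⟩
  · intro x hx y hy h
    simp only [Prod.mk.injEq] at h
    obtain ⟨e, he, i, j, hi, hj, hli, hlj⟩ := hlabels x hx y hy (hblock x hx y hy h.1)
    rw [hi, hj]
    congr 1
    exact Fin.ext (by rw [← hli, ← hlj, h.2])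
  · intro k x hx y hy
    constructor
    · intro hk
      have hlast : τ.last.proj x = τ.last.proj y := Quotient.sound (s := τ.last.rel)
        (hdec k (Fin.last n) (Fin.le_last k) x (hA x hx).2.1 y (hA y hy).2.1 hk)
      obtain ⟨e, he, i, j, hi, hj, hli, hlj⟩ := hlabels x hx y hy hlast
      refine ⟨by rw [hlast], ?_⟩
      rw [hli, hlj]
      refine leafRel_coe.2 ((he.part_iff k i j).2 ?_)
      rw [← hi, ← hj]
      exact (τ.part k).rel_iff.1 hk
    · rintro ⟨h1, h2⟩
      obtain ⟨e, he, i, j, hi, hj, hli, hlj⟩ := hlabels x hx y hy (hblock x hx y hy h1)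
      rw [hli, hlj] at h2
      have := (he.part_iff k i j).1 (leafRel_coe.1 h2)
      rw [← hi, ← hj] at this
      exact (τ.part k).rel_iff.2 this
  · intro B hB
    have hG : Measurable fun p : Tree n × X =>
        (p.1, massRank (τ.fibreFn p.1) (τ.last.fn p.2)) :=
      measurable_fst.prodMk ((measurable_kernel_massRank τ.fibreFn).comp
        (measurable_fst.prodMk (τ.last.measurable_fn.comp measurable_snd)))
    -- Disintegrating over trees turns the law of `P` into a mixture of the mass–rank laws of the
    -- fibres.
    have h1 : (τ.last.quotMeasure μ).map P = (τ.treeMeasure ⊗ₘ τ.fibreKernel).map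
        fun p => (p.1, massRank (τ.fibreFn p.1) (τ.last.fn p.2)) := by
      rw [hlaw, Measure.map_map hG htx, MeasurablePartition.quotMeasure,
        Measure.map_map hP τ.last.measurable_proj]
      rfl
    rw [h1, Measure.map_apply hG hB, Measure.compProd_apply (hG hB)]
    refine lintegral_congr fun T => ?_
    rw [Measure.map_apply (measurable_massRank _) (measurable_prodMk_left hB),
      τ.fibreFn_apply T ((measurable_massRank _) (measurable_prodMk_left hB))]
    rfl
  · intro B hB j
    have hint := setLIntegral_map (μ := τ.last.quotMeasure μ) hB
      (f := fun p : Tree n × (ℝ≥0∞ × ℝ≥0∞) => leafMass p.1 j)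
      ((measurable_leafMass j).comp measurable_fst) hP
    rw [hint]
    have hj : MeasurableSet (lab ⁻¹' {j}) := hlab (measurableSet_singleton j)
    have h1 := congrArg (fun ρ => ρ ((P ⁻¹' B) ×ˢ (lab ⁻¹' {j})))
      (τ.last.quotMeasure_compProd_condKernel μ)
    rw [Measure.compProd_apply_prod (hP hB) hj, Measure.map_apply τ.last.measurable_proj_prodMk
      ((hP hB).prod hj)] at h1
    refine (h1.symm.trans ?_)
    refine lintegral_congr_ae (ae_restrict_of_ae ?_)
    filter_upwards [hgood] with C ⟨e, he, hl⟩
    exact he.measure_preimage_eq_leafMass hl j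

end Model

theorem isomorphic_of_treeMeasure_eq {X' : Type*} [MeasurableSpace X'] [StandardBorelSpace X']
    {μ' : Measure X'} [IsProbabilityMeasure μ'] {τ : FiniteFiltration μ n}
    {τ' : FiniteFiltration μ' n} (hτ : τ.last.IsDiscrete μ) (hτ' : τ'.last.IsDiscrete μ')
    (h : τ.treeMeasure = τ'.treeMeasure)
    (hm : τ.multiplicity =ᵐ[τ.treeMeasure] τ'.multiplicity) : τ.Isomorphic τ' := by
  obtain ⟨P, lab, A, hP, hlab, hA, hμA, hinj, hrel, hlaw, hlaw2⟩ := exists_model hτ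
  obtain ⟨P', lab', A', hP', hlab', hA', hμA', hinj', hrel', hlaw', hlaw2'⟩ := exists_model hτ'
  -- Over almost every tree the multiplicities agree, so the mass–rank laws agree by
  -- `map_massRank_eq`; the mixing measures agree by `h`.
  have hlawP : (τ.last.quotMeasure μ).map P = (τ'.last.quotMeasure μ').map P' := by
    ext B hB
    rw [hlaw B hB, hlaw' B hB, ← h]
    refine lintegral_congr_ae ?_
    filter_upwards [hm] with T hT
    rw [multiplicity_eq, multiplicity_eq] at hT
    rw [map_massRank_eq hT]
  have hΨ : Measurable fun x => (P (τ.last.proj x), lab x) :=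
    (hP.comp τ.last.measurable_proj).prodMk hlab
  have hΨ' : Measurable fun x => (P' (τ'.last.proj x), lab' x) :=
    (hP'.comp τ'.last.measurable_proj).prodMk hlab'
  -- Given `P`, the leaf number has the masses of the canonical tree as its law, so it adds no new
  -- invariant.
  have hmap : μ.map (fun x => (P (τ.last.proj x), lab x)) =
      μ'.map fun x => (P' (τ'.last.proj x), lab' x) := by
    refine Measure.ext_prod fun {B S} hB hS => ?_
    rw [Measure.map_apply hΨ (hB.prod hS), Measure.map_apply hΨ' (hB.prod hS)]
    refine (measure_inter_preimage_eq_tsum μ (τ.last.measurable_proj (hP hB)) hlab S).trans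
      (Eq.trans ?_ (measure_inter_preimage_eq_tsum μ' (τ'.last.measurable_proj (hP' hB))
        hlab' S).symm)
    exact tsum_congr fun j => by rw [hlaw2 B hB, hlaw2' B hB, hlawP]
  obtain ⟨B, B', e, hBA, hBA', hB, hB', hμB, hμB', he, hee⟩ :=
    exists_equiv_of_map_eq hA hA' hμA hμA' hΨ hΨ' hinj hinj' hmap
  refine ⟨B, B', e, hB, hB', hμB, hμB', he, fun k x y => ?_⟩
  rw [hrel k x (hBA x.2) y (hBA y.2), hrel' k _ (hBA' (e x).2) _ (hBA' (e y).2)]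
  have hx := hee x
  have hy := hee y
  simp only [Prod.mk.injEq] at hx hy
  rw [hx.1, hx.2, hy.1, hy.2]

end FiniteFiltration

/-! ### Invariance under isomorphism -/

section Transport

variable {X X' : Type*} [MeasurableSpace X] [MeasurableSpace X']

theorem exists_measurePreserving_extension [Nonempty X'] {μ : Measure X} {μ' : Measure X'}
    {A : Set X} {A' : Set X'} (hA : MeasurableSet A) (hA' : MeasurableSet A') (hμA : μ Aᶜ = 0)
    (hμA' : μ' A'ᶜ = 0) {e : A → A'}
    (he : MeasurePreserving e (μ.comap Subtype.val) (μ'.comap Subtype.val)) :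
    ∃ f : X → X', MeasurePreserving f μ μ' ∧ ∀ x : A, f x = e x := by
  classical
  obtain ⟨x₀⟩ := ‹Nonempty X'›
  let f : X → X' := fun x => if h : x ∈ A then e ⟨x, h⟩ else x₀
  have hf : Measurable f := Measurable.dite (measurable_subtype_coe.comp he.measurable)
    measurable_const hA
  have hfe : ∀ x : A, f x = e x := fun x => dif_pos x.2
  have h1 : (μ.comap (Subtype.val : A → X)).map Subtype.val = μ := by
    rw [map_comap_subtype_coe hA, Measure.restrict_eq_self_of_ae_mem]
    exact hμA
  have h2 : (μ'.comap (Subtype.val : A' → X')).map Subtype.val = μ' := by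
    rw [map_comap_subtype_coe hA', Measure.restrict_eq_self_of_ae_mem]
    exact hμA'
  refine ⟨f, ⟨hf, ?_⟩, hfe⟩
  rw [← h1, Measure.map_map hf measurable_subtype_coe, ← h2, ← he.map_eq,
    Measure.map_map measurable_subtype_coe he.measurable]
  exact congrArg (Measure.map · _) (funext hfe)

theorem orderedSeq_map_of_ae_leftInverse [MeasurableSingletonClass X] [MeasurableSingletonClass X']
    {η : Measure X} {u : X → X'} {v : X' → X} (hu : Measurable u) (h : ∀ᵐ r ∂η, v (u r) = r) :
    (orderedSeq fun r => η {r}) = orderedSeq fun z => η.map u {z} := by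
  have hpre : ∀ z, η.map u {z} = η (u ⁻¹' {z}) := fun z =>
    Measure.map_apply hu (measurableSet_singleton z)
  have hatom : ∀ r, 0 < η {r} → v (u r) = r := fun r hr => by
    by_contra hne
    exact hr.ne' (measure_mono_null (Set.singleton_subset_iff.2 hne) h)
  have hmass : ∀ r, v (u r) = r → η.map u {u r} = η {r} := fun r hr => by
    rw [hpre]
    refine measure_congr ?_
    filter_upwards [h] with s hs
    refine propext ⟨fun (hsr : u s = u r) => ?_, fun (hsr : s = r) => ?_⟩
    · change s = r
      rw [← hs, hsr, hr]
    · change u s = u r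
      rw [hsr]
  refine orderedSeq_eq_of_bijOn u ⟨fun r (hr : 0 < η {r}) => ?_, fun r hr s hs hrs => ?_,
    fun z (hz : 0 < η.map u {z}) => ?_⟩ fun r hr => hmass r (hatom r hr)
  · change 0 < η.map u {u r}
    rwa [hmass r (hatom r hr)]
  · rw [← hatom r hr, ← hatom s hs, hrs]
  · have hz' := hz
    rw [hpre] at hz'
    have hne : ∃ r, u r = z ∧ v (u r) = r := by
      by_contra hno
      push Not at hno
      exact hz'.ne' (measure_mono_null hno h)
    obtain ⟨r, rfl, hr⟩ := hne
    refine ⟨r, ?_, rfl⟩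
    change 0 < η {r}
    rwa [← hmass r hr]

/-- A map that is injective and respects the partitions on a set of full measure moves the atoms
with their masses, so the same tree still labels them. -/
theorem IsLabelling.map [MeasurableSingletonClass X] [MeasurableSingletonClass X'] {n : ℕ}
    {f : Fin (n + 1) → X → ℝ} {f' : Fin (n + 1) → X' → ℝ} {ρ : Measure X} [IsProbabilityMeasure ρ]
    {M : LabelledTree n} {e : Fin M.1.card → X} (h : IsLabelling f ρ M e) {g : X → X'}
    (hg : Measurable g) {A : Set X} (hA : ∀ᵐ x ∂ρ, x ∈ A) (hinj : Set.InjOn g A)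
    (hff : ∀ k, ∀ x ∈ A, ∀ y ∈ A, f k x = f k y ↔ f' k (g x) = f' k (g y)) :
    IsLabelling f' (ρ.map g) M (g ∘ e) := by
  have heA : ∀ i, e i ∈ A := h.forall_of_ae hA
  have hrange : ∀ᵐ x ∂ρ, x ∈ Set.range e := h.measure_compl_range
  have hmass : ∀ i, ρ.map g {g (e i)} = ρ {e i} := fun i => by
    rw [Measure.map_apply hg (measurableSet_singleton _)]
    refine measure_congr ?_
    filter_upwards [hA] with x hx
    refine propext ⟨fun (hxi : g x = g (e i)) => hinj hx (heA i) hxi, fun (hxi : x = e i) => ?_⟩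
    change g x = g (e i)
    rw [hxi]
  refine ⟨fun i j hij => h.injective (hinj (heA i) (heA j) hij), ?_, fun i => ?_, fun k i j => ?_⟩
  · ext y
    constructor
    · rintro ⟨i, rfl⟩
      change 0 < ρ.map g {g (e i)}
      rw [hmass]
      exact h.range_eq.subset ⟨i, rfl⟩
    · intro (hy : 0 < ρ.map g {y})
      rw [Measure.map_apply hg (measurableSet_singleton _)] at hy
      by_contra hno
      refine hy.ne' (measure_mono_null ?_ hrange)
      rintro _ hx ⟨i, rfl⟩
      exact hno ⟨i, hx⟩
  · rw [h.mass_eq, ← hmass]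
    rfl
  · rw [h.part_iff, hff k _ (heA i) _ (heA j)]
    rfl

end Transport

namespace FiniteFiltration

variable {X : Type*} [MeasurableSpace X] {μ : Measure X} {n : ℕ} {τ : FiniteFiltration μ n}
  {X' : Type*} [MeasurableSpace X'] {μ' : Measure X'} {τ' : FiniteFiltration μ' n}

/-- An isomorphism of filtrations, extended to the whole space. -/
theorem Isomorphic.exists_measurePreserving [Nonempty X'] (h : τ.Isomorphic τ') :
    ∃ (f : X → X') (A : Set X), MeasurePreserving f μ μ' ∧ MeasurableSet A ∧ μ Aᶜ = 0 ∧
      Set.InjOn f A ∧ ∀ k, ∀ x ∈ A, ∀ y ∈ A,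
        τ.fns k x = τ.fns k y ↔ τ'.fns k (f x) = τ'.fns k (f y) := by
  obtain ⟨A, A', e, hA, hA', hμA, hμA', he, hrel⟩ := h
  obtain ⟨f, hf, hfe⟩ := exists_measurePreserving_extension hA hA' hμA hμA' he
  refine ⟨f, A, hf, hA, hμA, fun x hx y hy hxy => ?_, fun k x hx y hy => ?_⟩
  · rw [hfe ⟨x, hx⟩, hfe ⟨y, hy⟩] at hxy
    exact congrArg Subtype.val (e.injective (Subtype.ext hxy))
  · rw [hfe ⟨x, hx⟩, hfe ⟨y, hy⟩]
    exact ((τ.part k).rel_iff.symm.trans (hrel k ⟨x, hx⟩ ⟨y, hy⟩)).trans (τ'.part k).rel_iff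

variable [StandardBorelSpace X] [IsProbabilityMeasure μ] [StandardBorelSpace X']
  [IsProbabilityMeasure μ']

/-- The tree map is only almost everywhere measurable. This allows the fibre kernel to be computed
from a measurable version of it. -/
theorem fibreKernel_ae_eq (hτ : τ.last.IsDiscrete μ) {t : X → Tree n}
    (h : ∀ᵐ x ∂μ, τ.treeMap (τ.last.proj x) = t x) :
    haveI : Nonempty X := nonempty_of_isProbabilityMeasure μ
    condDistrib id t μ =ᵐ[μ.map t] τ.fibreKernel := by
  have : Nonempty X := nonempty_of_isProbabilityMeasure μ
  refine condDistrib_ae_eq_of_measure_eq_compProd t aemeasurable_id ?_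
  have h1 : μ.map t = τ.treeMeasure := by
    rw [treeMeasure_eq_map hτ]
    refine Measure.map_congr ?_
    filter_upwards [h] with x hx using hx.symm
  rw [h1, treeMeasure_compProd_fibreKernel hτ]
  refine Measure.map_congr ?_
  filter_upwards [h] with x hx
  rw [hx]
  rfl

/-- Isomorphic filtrations have equal measures on trees and equal multiplicities. -/
theorem Isomorphic.treeMeasure_eq (h : τ.Isomorphic τ') (hτ : τ.last.IsDiscrete μ)
    (hτ' : τ'.last.IsDiscrete μ') :
    τ.treeMeasure = τ'.treeMeasure ∧ τ.multiplicity =ᵐ[τ.treeMeasure] τ'.multiplicity := by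
  have : Nonempty X := nonempty_of_isProbabilityMeasure μ
  have : Nonempty X' := nonempty_of_isProbabilityMeasure μ'
  obtain ⟨f, A, hf, hA, hμA, hinj, hrel⟩ := h.exists_measurePreserving
  have hAae : ∀ᵐ x ∂μ, x ∈ A := hμA
  have hfn' : Measurable fun x => τ'.last.fn (f x) := τ'.last.measurable_fn.comp hf.measurable
  -- The isomorphism matches the blocks of the last partitions, so their generating values are Borel
  -- functions of each other: `u` and `v` are mutually inverse almost everywhere.
  obtain ⟨u, hu, hu'⟩ := exists_measurable_factor hA τ.last.measurable_fn hfn'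
    fun x hx y hy hxy => (hrel (Fin.last n) x hx y hy).1 hxy
  obtain ⟨v, hv, hv'⟩ := exists_measurable_factor hA hfn' τ.last.measurable_fn
    fun x hx y hy hxy => (hrel (Fin.last n) x hx y hy).2 hxy
  have hcond : ∀ᵐ x ∂μ, (τ.last.condMeasure μ (τ.last.proj x)).map f =
      τ'.last.condMeasure μ' (τ'.last.proj (f x)) := by
    have h1 := ae_of_ae_map τ.last.measurable_fn.aemeasurable
      (condDistrib_map_eq_of_compatible τ.last.measurable_fn τ'.last.measurable_fn hf hu
        (by filter_upwards [hAae] with x hx using hu' x hx)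
        fun B hB => ⟨v ⁻¹' B, hv hB, by
          filter_upwards [hAae] with x hx
          rw [Set.mem_preimage, ← hv' x hx]⟩)
    filter_upwards [h1, hAae,
      τ.last.ae_quotMeasure_iff μ (τ.last.condMeasure_ae_eq_condDistrib μ),
      hf.quasiMeasurePreserving.ae
        (τ'.last.ae_quotMeasure_iff μ' (τ'.last.condMeasure_ae_eq_condDistrib μ'))]
      with x hx hxA hc hc'
    rw [hc, hc', MeasurablePartition.quotFn_proj, MeasurablePartition.quotFn_proj, hx, hu' x hxA]
  have htree : ∀ᵐ x ∂μ, τ'.treeMap (τ'.last.proj (f x)) = τ.treeMap (τ.last.proj x) := by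
    filter_upwards [hcond, τ.last.ae_quotMeasure_iff μ (τ.ae_exists_isLabelling hτ),
      τ.last.ae_quotMeasure_iff μ (τ.last.ae_condMeasure_of_ae μ hAae)] with x hx ⟨M, e, he⟩ hxA
    have he' := he.map hf.measurable hxA hinj hrel
    rw [hx] at he'
    rw [τ.treeMap_eq_of_isLabelling he, τ'.treeMap_eq_of_isLabelling he']
  obtain ⟨t, ht, htt⟩ := aemeasurable_treeMap_proj hτ
  obtain ⟨t', ht', htt'⟩ := aemeasurable_treeMap_proj hτ'
  have htt'f := hf.quasiMeasurePreserving.ae htt'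
  have htf : ∀ᵐ x ∂μ, t' (f x) = t x := by
    filter_upwards [htree, htt, htt'f] with x h1 h2 h3
    rw [← h3, ← h2, h1]
  have hω : τ.treeMeasure = μ.map t := by
    rw [treeMeasure_eq_map hτ]
    exact Measure.map_congr htt
  have hω' : τ'.treeMeasure = μ'.map t' := by
    rw [treeMeasure_eq_map hτ']
    exact Measure.map_congr htt'
  have heq : τ.treeMeasure = τ'.treeMeasure := by
    rw [hω, hω', ← hf.map_eq, Measure.map_map ht' hf.measurable]
    refine Measure.map_congr ?_
    filter_upwards [htf] with x hx using hx.symm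
  refine ⟨heq, ?_⟩
  have := isProbabilityMeasure_treeMeasure hτ
  have hker : ∀ᵐ T ∂τ.treeMeasure, (τ.fibreKernel T).map f = τ'.fibreKernel T := by
    have h1 := condDistrib_map_eq_of_compatible ht ht' hf measurable_id htf fun B hB =>
      ⟨B, hB, by filter_upwards [htf] with x hx; rw [hx]⟩
    rw [← hω] at h1
    have h2 := fibreKernel_ae_eq hτ htt
    have h3 := fibreKernel_ae_eq hτ' htt'
    rw [← hω] at h2
    rw [← hω', ← heq] at h3
    filter_upwards [h1, h2, h3] with T hT1 hT2 hT3
    rw [← hT2, hT1, ← hT3]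
    rfl
  have hAker : ∀ᵐ T ∂τ.treeMeasure, ∀ᵐ x ∂(τ.fibreKernel T), x ∈ A := by
    refine Measure.ae_ae_of_ae_compProd (p := fun q : Tree n × X => q.2 ∈ A) ?_
    have hp : AEMeasurable (fun x => (τ.treeMap (τ.last.proj x), x)) μ :=
      (aemeasurable_treeMap_proj hτ).prodMk aemeasurable_id
    rw [treeMeasure_compProd_fibreKernel hτ, ae_map_iff hp (measurable_snd hA)]
    exact hAae
  filter_upwards [hker, hAker] with T hT hTA
  rw [multiplicity_eq, multiplicity_eq]
  -- On the line the fibre measures correspond under `u`, and `v` undoes `u` almost everywhere, so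
  -- the masses of their atoms agree.
  have hfn : τ'.fibreFn T = (τ.fibreFn T).map u := by
    rw [fibreFn, fibreFn, Kernel.map_apply _ τ'.last.measurable_fn,
      Kernel.map_apply _ τ.last.measurable_fn, ← hT,
      Measure.map_map τ'.last.measurable_fn hf.measurable,
      Measure.map_map hu τ.last.measurable_fn]
    refine Measure.map_congr ?_
    filter_upwards [hTA] with x hx using hu' x hx
  rw [hfn]
  refine orderedSeq_map_of_ae_leftInverse (v := v) hu ?_
  have hset : MeasurableSet {r | v (u r) = r} := measurableSet_eq_fun (hv.comp hu) measurable_id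
  rw [fibreFn, Kernel.map_apply _ τ.last.measurable_fn,
    ae_map_iff τ.last.measurable_fn.aemeasurable hset]
  filter_upwards [hTA] with x hx
  rw [← hu' x hx, ← hv' x hx]

end FiniteFiltration

/-! ### Finitely many metric types -/

section SortedTrees

variable {n : ℕ}

theorem exists_antitone_representative (T : Tree n) :
    ∃ M : LabelledTree n, Quotient.mk _ M = T ∧ Antitone M.mass := by
  obtain ⟨M, rfl⟩ := Quotient.exists_rep T
  obtain ⟨σ, hσ⟩ := exists_antitone_comp_perm M.mass
  exact ⟨LabelledTree.relabel M.1 σ M.2, Quotient.sound (LabelledTree.relabel_iso M.1 σ M.2), hσ⟩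

theorem support_orderedSeq_mass {M : LabelledTree n} (hM : Antitone M.mass) :
    Function.support (orderedSeq M.mass) = Set.Iio M.1.card := by
  ext i
  rw [Function.mem_support, orderedSeq_of_antitone hM, Set.mem_Iio]
  split_ifs with h
  · exact ⟨fun _ => h, fun _ => (M.2.2.1 _).ne'⟩
  · simp [h]

theorem card_eq_ncard_support {M : LabelledTree n} (hM : Antitone M.mass) :
    M.1.card = (Function.support (orderedSeq M.mass)).ncard := by
  rw [support_orderedSeq_mass hM, ← Finset.coe_Iio, Set.ncard_coe_finset, Nat.card_Iio]

theorem eq_of_orderedSeq_mass_eq {M N : LabelledTree n} (hM : Antitone M.mass)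
    (hN : Antitone N.mass) (hs : M.1 = N.1) (h : orderedSeq M.mass = orderedSeq N.mass) :
    M = N := by
  obtain ⟨s, w⟩ := M
  obtain ⟨s', w'⟩ := N
  obtain rfl : s = s' := hs
  congr 1
  refine Subtype.ext (funext fun i => ?_)
  have := congrFun h i
  rw [orderedSeq_of_antitone hM, orderedSeq_of_antitone hN, dif_pos i.2, dif_pos i.2] at this
  exact this

/-- Each tree has a representative with sorted masses, determined by its shape and by `v`. The
support of `v` fixes the number of leaves, which leaves finitely many shapes. -/
theorem finite_leafVector_preimage (v : ℕ → ℝ≥0∞) : {T : Tree n | leafVector n T = v}.Finite := by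
  have hfin : {M : LabelledTree n | Antitone M.mass ∧ orderedSeq M.mass = v}.Finite := by
    refine Set.Finite.of_finite_image (f := Sigma.fst) ((TreeShape.finite_setOf_card_eq n
      (Function.support v).ncard).subset ?_) ?_
    · rintro _ ⟨M, ⟨hM, rfl⟩, rfl⟩
      exact card_eq_ncard_support hM
    · rintro M ⟨hM, hMv⟩ N ⟨hN, hNv⟩ h
      exact eq_of_orderedSeq_mass_eq hM hN h (hMv.trans hNv.symm)
  refine (hfin.image (Quotient.mk _)).subset ?_
  intro T (hT : leafVector n T = v)
  obtain ⟨M, rfl, hM⟩ := exists_antitone_representative T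
  exact ⟨M, ⟨hM, hT⟩, rfl⟩

end SortedTrees

namespace FiniteFiltration

variable {X : Type*} [MeasurableSpace X] {μ : Measure X} {n : ℕ} {τ : FiniteFiltration μ n}
  [StandardBorelSpace X] [IsProbabilityMeasure μ]

theorem ae_leafVector_treeMap (hτ : τ.last.IsDiscrete μ) : ∀ᵐ C ∂(τ.last.quotMeasure μ),
    leafVector n (τ.treeMap C) = atomSeq (τ.last.condMeasure μ C) := by
  filter_upwards [τ.ae_exists_isLabelling hτ] with C ⟨M, e, he⟩
  rw [τ.treeMap_eq_of_isLabelling he]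
  refine orderedSeq_eq_of_bijOn e ⟨fun i _ => ?_, he.injective.injOn, fun y hy => ?_⟩
    fun i _ => (he.mass_eq i).symm
  · rw [← he.range_eq]
    exact ⟨i, rfl⟩
  · rw [← he.range_eq] at hy
    obtain ⟨i, rfl⟩ := hy
    exact ⟨i, M.2.2.1 i, rfl⟩

theorem exists_finite_treeMeasure_compl_eq_zero (hτ : τ.last.IsDiscrete μ)
    (h : τ.last.HasFinitelyManyTypes μ) :
    ∃ F : Set (Tree n), F.Finite ∧ τ.treeMeasure Fᶜ = 0 := by
  obtain ⟨V, hV, h⟩ := h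
  have hF : {T : Tree n | leafVector n T ∈ V}.Finite := by
    have : {T : Tree n | leafVector n T ∈ V} = ⋃ v ∈ V, {T | leafVector n T = v} := by
      ext T
      simp
    rw [this]
    exact hV.biUnion fun v _ => finite_leafVector_preimage v
  refine ⟨_, hF, ?_⟩
  rw [treeMeasure, Measure.map_apply_of_aemeasurable (τ.aemeasurable_treeMap hτ)
    hF.measurableSet.compl]
  have hae : ∀ᵐ C ∂(τ.last.quotMeasure μ), leafVector n (τ.treeMap C) ∈ V := by
    filter_upwards [h, ae_leafVector_treeMap hτ] with C hC hCv using hCv ▸ hC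
  exact measure_mono_null (fun _ hC => hC) (ae_iff.1 hae)

/-- The multiplicities over atoms of the measure on trees are continual. -/
theorem multiplicity_eq_zero_of_treeMeasure_ne_zero [NullSingletonClass μ]
    (hτ : τ.last.IsDiscrete μ) {T : Tree n} (hT : τ.treeMeasure {T} ≠ 0) :
    τ.multiplicity T = 0 := by
  have := isProbabilityMeasure_treeMeasure hτ
  rw [multiplicity_eq]
  refine orderedSeq_eq_zero fun r => ?_
  have hS : MeasurableSet (τ.last.fn ⁻¹' {r}) :=
    τ.last.measurable_fn (measurableSet_singleton r)
  rw [τ.fibreFn_apply T (measurableSet_singleton r)]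
  have h0 : μ (τ.last.fn ⁻¹' {r}) = 0 := by
    rcases (τ.last.fn ⁻¹' {r}).eq_empty_or_nonempty with he | ⟨x, rfl⟩
    · rw [he, measure_empty]
    · refine measure_mono_null (fun y (hy : τ.last.fn y = τ.last.fn x) => ?_)
        (τ.last.measure_block_eq_zero μ hτ (τ.last.proj x))
      exact τ.last.proj_eq_iff.2 hy
  -- Evaluating the disintegration on a rectangle gives the mass of `T` times the fibre mass of a
  -- block. The product is at most the measure of that block, which is zero, and the first factor is
  -- not.
  have h := congrArg (fun ρ => ρ ({T} ×ˢ (τ.last.fn ⁻¹' {r}))) (treeMeasure_compProd_fibreKernel hτ)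
  have hp : AEMeasurable (fun x => (τ.treeMap (τ.last.proj x), x)) μ :=
    (aemeasurable_treeMap_proj hτ).prodMk aemeasurable_id
  rw [Measure.compProd_apply_prod (measurableSet_singleton T) hS, Measure.restrict_singleton,
    lintegral_smul_measure, lintegral_dirac, Measure.map_apply_of_aemeasurable hp
      ((measurableSet_singleton T).prod hS), smul_eq_mul] at h
  have h0' : μ ((fun x => (τ.treeMap (τ.last.proj x), x)) ⁻¹' ({T} ×ˢ (τ.last.fn ⁻¹' {r}))) = 0 :=
    measure_mono_null (fun x hx => hx.2) h0
  rw [h0', mul_eq_zero] at h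
  exact h.resolve_left hT

theorem ae_multiplicity_eq_zero [NullSingletonClass μ] (hτ : τ.last.IsDiscrete μ)
    {F : Set (Tree n)} (hF : F.Finite) (h : τ.treeMeasure Fᶜ = 0) :
    ∀ᵐ T ∂τ.treeMeasure, τ.multiplicity T = 0 := by
  have h' : τ.treeMeasure {T ∈ F | τ.treeMeasure {T} = 0} = 0 := by
    rw [← Set.biUnion_of_singleton {T ∈ F | τ.treeMeasure {T} = 0}]
    exact (measure_biUnion_null_iff (hF.subset fun T hT => hT.1).countable).2 fun T hT => hT.2
  have hFae : ∀ᵐ T ∂τ.treeMeasure, T ∈ F := h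
  have hae : ∀ᵐ T ∂τ.treeMeasure, ¬ (T ∈ F ∧ τ.treeMeasure {T} = 0) := by
    rw [ae_iff]
    simpa using! h'
  filter_upwards [hFae, hae] with T hT hT'
  exact multiplicity_eq_zero_of_treeMeasure_ne_zero hτ fun h0 => hT' ⟨hT, h0⟩

end FiniteFiltration

/-! ### A single partition: trees as ordered probability vectors -/

theorem measurable_orderedSeq {k : ℕ} (i : ℕ) :
    Measurable fun w : Fin k → ℝ≥0∞ => orderedSeq w i := by
  refine measurable_of_Ici fun c => ?_
  rcases eq_or_ne c 0 with rfl | hc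
  · simp
  have : (fun w : Fin k → ℝ≥0∞ => orderedSeq w i) ⁻¹' Set.Ici c =
      ⋃ S ∈ {S : Finset (Fin k) | i + 1 ≤ S.card}, ⋂ y ∈ S, {w | c ≤ w y} := by
    ext w
    simp only [Set.mem_preimage, Set.mem_Ici, Set.mem_iUnion, Set.mem_iInter, Set.mem_ofPred_eq,
      exists_prop]
    rw [le_orderedSeq_iff (fun _ _ => Set.toFinite _) (pos_iff_ne_zero.2 hc)]
    constructor
    · intro h
      refine ⟨(Set.toFinite {y | c ≤ w y}).toFinset, ?_, fun y hy => by simpa using! hy⟩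
      rw [(Set.toFinite _).encard_eq_coe_toFinset_card] at h
      exact_mod_cast h
    · rintro ⟨S, hS, h⟩
      refine le_trans ?_ (Set.encard_le_encard (s := (S : Set (Fin k))) fun y hy => h y hy)
      rw [Set.encard_coe_eq_coe_finsetCard]
      exact_mod_cast hS
  rw [this]
  exact MeasurableSet.biUnion (Set.to_countable _) fun S _ =>
    MeasurableSet.biInter (Finset.countable_toSet S) fun y _ =>
      measurableSet_le measurable_const (measurable_pi_apply y)

theorem measurable_leafVector (n : ℕ) : Measurable (leafVector n) := by
  refine measurable_pi_iff.2 fun i => measurable_from_quotient.2 (measurable_sigma_iff.2 fun s => ?_)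
  exact (measurable_orderedSeq i).comp (measurable_subtype_coe
    (p := fun w : Fin s.card → ℝ≥0∞ => (∀ i, 0 < w i) ∧ ∑ i, w i = 1))

/-- There are only two levels, and the partitions of both are prescribed. -/
theorem TreeShape.eq_of_card_eq {s t : TreeShape 1} (h : s.card = t.card) : s = t := by
  obtain ⟨c, p, _, h0, h1⟩ := s
  obtain ⟨c', p', _, h0', h1'⟩ := t
  obtain rfl : c = c' := h
  congr
  funext k
  fin_cases k
  · exact h0.trans h0'.symm
  · exact h1.trans h1'.symm

theorem leafVector_injective : Function.Injective (leafVector 1) := by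
  intro T T' h
  obtain ⟨M, rfl, hM⟩ := exists_antitone_representative T
  obtain ⟨N, rfl, hN⟩ := exists_antitone_representative T'
  have h : orderedSeq M.mass = orderedSeq N.mass := h
  rw [eq_of_orderedSeq_mass_eq hM hN (TreeShape.eq_of_card_eq ?_) h]
  rw [card_eq_ncard_support hM, card_eq_ncard_support hN, h]

theorem tsum_orderedSeq_mass {n : ℕ} {M : LabelledTree n} (hM : Antitone M.mass) :
    ∑' i, orderedSeq M.mass i = 1 := by
  rw [← M.2.2.2, tsum_eq_sum (s := Finset.range M.1.card), Finset.sum_range]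
  · refine Finset.sum_congr rfl fun i _ => ?_
    rw [orderedSeq_of_antitone hM, dif_pos i.2]
    rfl
  · intro i hi
    rw [orderedSeq_of_antitone hM, dif_neg (by simpa using hi)]

/-- The tree of a single partition with the given masses. -/
def LabelledTree.star {k : ℕ} (w : PosProbVector k) : LabelledTree 1 :=
  ⟨{ card := k
     part := fun l => if l = 0 then ⊥ else ⊤
     mono := fun l m h => by
       by_cases hm : m = 0
       · have hl : l = 0 := Fin.le_zero_iff.1 (hm ▸ h)
         simp [hl, hm]
       · simp [hm]
     part_zero := by simp
     part_last := by simp }, w⟩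

theorem range_leafVector : Set.range (leafVector 1) =
    {v | Antitone v ∧ (Function.support v).Finite ∧ ∑' i, v i = 1} := by
  ext v
  constructor
  · rintro ⟨T, rfl⟩
    obtain ⟨M, rfl, hM⟩ := exists_antitone_representative T
    refine ⟨orderedSeq_antitone _, ?_, tsum_orderedSeq_mass hM⟩
    have := support_orderedSeq_mass hM
    exact this ▸ Set.finite_Iio _
  · rintro ⟨hv, hfin, hsum⟩
    classical
    have hex : ∃ k, v k = 0 := by
      obtain ⟨k, hk⟩ := hfin.exists_notMem
      exact ⟨k, by simpa using hk⟩
    -- The first zero of `v` is the number of leaves; monotonicity makes all later terms vanish.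
    obtain ⟨k, hk, hmin⟩ : ∃ k, v k = 0 ∧ ∀ i < k, v i ≠ 0 :=
      ⟨Nat.find hex, Nat.find_spec hex, fun i hi => Nat.find_min hex hi⟩
    have hge : ∀ i, k ≤ i → v i = 0 := fun i hi => le_antisymm ((hv hi).trans hk.le) zero_le
    let w : PosProbVector k := ⟨fun i => v i, fun i => pos_iff_ne_zero.2 (hmin i i.2), by
      rw [← Finset.sum_range, ← hsum, tsum_eq_sum]
      intro i hi
      exact hge i (by simpa using hi)⟩
    refine ⟨Quotient.mk _ (LabelledTree.star w), ?_⟩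
    have hw : Antitone (LabelledTree.star w).mass := fun i j hij => hv hij
    funext i
    refine (orderedSeq_of_antitone hw i).trans ?_
    split_ifs with hi
    · rfl
    · exact (hge i (not_lt.1 hi)).symm

/-- Injective Borel maps between standard Borel spaces are embeddings, so measurability of the
inverse is automatic. -/
theorem measurableEmbedding_leafVector : MeasurableEmbedding (leafVector 1) :=
  (measurable_leafVector 1).measurableEmbedding leafVector_injective

theorem FiniteFiltration.map_leafVector_treeMeasure {X : Type*} [MeasurableSpace X] {μ : Measure X}
    {n : ℕ} {τ : FiniteFiltration μ n} [StandardBorelSpace X] [IsProbabilityMeasure μ]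
    (hτ : τ.last.IsDiscrete μ) : τ.treeMeasure.map (leafVector n) =
      (τ.last.quotMeasure μ).map fun C => atomSeq (τ.last.condMeasure μ C) := by
  rw [FiniteFiltration.treeMeasure, AEMeasurable.map_map_of_aemeasurable
    (measurable_leafVector n).aemeasurable (τ.aemeasurable_treeMap hτ)]
  exact Measure.map_congr (ae_leafVector_treeMap hτ)

end VershikFiltration

theorem theorem4 (n : ℕ)
    {X : Type*} [MeasurableSpace X] [StandardBorelSpace X]
    (μ : Measure X) [IsProbabilityMeasure μ] [NullSingletonClass μ]
    {X' : Type*} [MeasurableSpace X'] [StandardBorelSpace X']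
    (μ' : Measure X') [IsProbabilityMeasure μ'] [NullSingletonClass μ']
    (τ : VershikFiltration.FiniteFiltration μ n) (hτ : τ.IsDiscrete)
    (τ' : VershikFiltration.FiniteFiltration μ' n) (hτ' : τ'.IsDiscrete) :
    -- the homomorphism to the space of trees is well defined
    (AEMeasurable τ.treeMap (τ.last.quotMeasure μ) ∧
      ∀ᵐ C ∂(τ.last.quotMeasure μ), ∃ M, τ.Represents C M ∧ τ.treeMap C = Quotient.mk _ M) ∧
    -- completeness of the image measure together with the multiplicity function
    (τ.Isomorphic τ' ↔
      τ.treeMeasure = τ'.treeMeasure ∧ τ.multiplicity =ᵐ[τ.treeMeasure] τ'.multiplicity) ∧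
    -- finitely many types of conditional measures
    (τ.HasFinitelyManyTypes →
      (∃ F : Set (VershikFiltration.Tree n), F.Finite ∧ τ.treeMeasure Fᶜ = 0) ∧
      (∀ᵐ T ∂τ.treeMeasure, τ.multiplicity T = 0) ∧
      (τ.Isomorphic τ' ↔ τ.treeMeasure = τ'.treeMeasure)) ∧
    -- a single partition: a measure on ordered probability vectors
    (n = 1 →
      MeasurableEmbedding (VershikFiltration.leafVector n) ∧
      Set.range (VershikFiltration.leafVector n) =
        {v | Antitone v ∧ (Function.support v).Finite ∧ ∑' i, v i = 1} ∧
      τ.treeMeasure.map (VershikFiltration.leafVector n) =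
        (τ.last.quotMeasure μ).map
          fun C => VershikFiltration.atomSeq (τ.last.condMeasure μ C)) := by
  have h := hτ (Fin.last n)
  have h' := hτ' (Fin.last n)
  have hiso : τ.Isomorphic τ' ↔
      τ.treeMeasure = τ'.treeMeasure ∧ τ.multiplicity =ᵐ[τ.treeMeasure] τ'.multiplicity :=
    ⟨fun hi => hi.treeMeasure_eq h h', fun hm =>
      VershikFiltration.FiniteFiltration.isomorphic_of_treeMeasure_eq h h' hm.1 hm.2⟩
  refine ⟨⟨τ.aemeasurable_treeMap h, τ.ae_represents h⟩, hiso, fun hfin => ?_, ?_⟩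
  · obtain ⟨F, hF, hF0⟩ :=
      VershikFiltration.FiniteFiltration.exists_finite_treeMeasure_compl_eq_zero h
        (hfin (Fin.last n))
    have hm := VershikFiltration.FiniteFiltration.ae_multiplicity_eq_zero h hF hF0
    refine ⟨⟨F, hF, hF0⟩, hm, hiso.trans ⟨And.left, fun heq => ⟨heq, ?_⟩⟩⟩
    -- The finiteness hypothesis concerns `τ` only, but the finite carrier passes to `τ'` through
    -- the equality of the measures on trees.
    have hm' := VershikFiltration.FiniteFiltration.ae_multiplicity_eq_zero h' hF (heq ▸ hF0)
    rw [← heq] at hm'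
    filter_upwards [hm, hm'] with T hT hT'
    rw [hT, hT']
  · rintro rfl
    exact ⟨VershikFiltration.measurableEmbedding_leafVector, VershikFiltration.range_leafVector,
      VershikFiltration.FiniteFiltration.map_leafVector_treeMeasure h⟩
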